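/- **Setting.** Let $p$ be a prime and let $v_T$ be the $T$-adic valuation on $\mathbb{F}_p[[T]]$. Let $R$ be a (not necessarily commutative) ring with unit, $\pi:R\to\mathbb{F}_p[[T]]$ a surjective ring homomorphism with kernel $\mathfrak m$, and $\tilde T\in R$ a central element which is not a zero divisor and satisfies $\pi(\tilde T)=T$. Let $J=(\mathfrak m,\tilde T)$ be the two-sided ideal generated by $\mathfrak m$ and $\tilde T$. Assume that $R$ is complete and separated for the $J$-adic topology, i.e. $R\cong\varprojlim_n R/J^n$, and that every $\bar x\in\mathbb{F}_p[[T]]$ has a special lift: an $x\in R$ with $\pi(x)=\bar x$ and $v_{\tilde T}(x)=v_T(\bar x)$, where $v_{\tilde T}(x)=\sup\{n: x\in\tilde T^nR\}$. **Matrices.** $\mathrm M_\infty(R)$ is the set of matrices over $R$ with rows and columns indexed by $1,2,3,\dots$. Entries of products are given by $J$-adically convergent series. $\mathrm{GL}_\infty(R)$ is the group of units of the ring of those infinite matrices each of whose columns tends to $0$ in the $J$-adic topology. Let $\lambda_1\le\lambda_2\le\cdots$ be a sequence of nonnegative integers tending to infinity. A matrix $M\in\mathrm M_\infty(R)$ is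 *$\underline\lambda$-Hodge bounded* if $M=\mathrm{Diag}(\tilde T^{\lambda_1},\tilde T^{\lambda_2},\dots)M'$ for some $M'\in\mathrm M_\infty(R)$. A matrix $A\in\mathrm M_\infty(R)$ is *$\underline\lambda$-stable* if, for every $\underline\lambda$-Hodge bounded $B\in\mathrm M_\infty(R)$, the product $AB$ is $\underline\lambda$-Hodge bounded. **Newton and Hodge functions.** For a $\underline\lambda$-Hodge bounded $M\in \mathrm M_\infty(R)$, let $\bar M\in\mathrm M_\infty(\mathbb{F}_p[[T]])$ be its entrywise image under $\pi$. For $k\ge 0$ let $N(\bar M,k)$ be the $T$-adic valuation of the ($T$-adically convergent) sum of all principal $k\times k$ minors of $\bar M$, and let $H(\bar M,k)$ be the minimum of the valuations of all $k\times k$ minors of $\bar M$; for $k=0$ both are $0$. The Newton polygon of $\bar M$ is the lower convex hull of the points $(k,N(\bar M,k))$, $k\ge0$ (points with $N(\bar M,k)=\infty$ being omitted). An integer $k\geq 0$ is a *touching vertex* of $\bar M$ if $(k,N(\bar M,k))$ is a vertex of the Newton polygon and $N(\bar M,k)=H(\bar M,k)$. **Theorem.** Let $M\in\mathrm M_\infty(R)$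 be $\underline\lambda$-Hodge bounded, and let $s_1<s_2<\cdots$ be an infinite sequence of touching vertices of $\bar M$ such that $N(\bar M,s_k)=\sum_{i=1}^{s_k}\lambda_i$ for all $k\geq 1$. Then there exists a $\underline\lambda$-stable matrix $Q\in\mathrm{GL}_\infty(R)$ such that $QMQ^{-1}$ is $\underline\lambda$-Hodge bounded and block upper triangular, $$QMQ^{-1}=\begin{bmatrix}M_{11}&M_{12}\\0&M_{22}\end{bmatrix},$$ with $M_{11}$ of size $s_1\times s_1$. -/

import Mathlib

open Filter

noncomputable section

namespace NewtonHodge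

/-! ### Newton and Hodge functions of matrices over a power series ring

Rows and columns of an infinite matrix are indexed by `ℕ`, so that index `i` here is the index
`i + 1` of the usual numbering `1, 2, 3, …`. The subsets of `ℕ` with `k` elements are given by
their increasing enumerations `Fin k ↪o ℕ`. -/

section PowerSeriesMatrices

variable {K : Type*} [CommRing K]

/-- The sum of all principal `k × k` minors of an infinite matrix over `K⟦T⟧`, as a `T`-adically
convergent series: its coefficient of `T ^ n` is the sum of the coefficients of `T ^ n` of the
minors. For Hodge bounded matrices only finitely many terms of each of these sums are nonzero
(see `finite_support_coeff_minor`). -/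
def principalMinorSum (M : Matrix ℕ ℕ (PowerSeries K)) (k : ℕ) : PowerSeries K :=
  PowerSeries.mk fun n => ∑ᶠ f : Fin k ↪o ℕ, PowerSeries.coeff n (M.submatrix f f).det

/-- The Newton function `N(M, k)`: the `T`-adic valuation of the sum of all principal `k × k`
minors. -/
def newtonFunction (M : Matrix ℕ ℕ (PowerSeries K)) (k : ℕ) : ℕ∞ :=
  (principalMinorSum M k).order

/-- The Hodge function `H(M, k)`: the least `T`-adic valuation of a `k × k` minor. -/
def hodgeFunction (M : Matrix ℕ ℕ (PowerSeries K)) (k : ℕ) : ℕ∞ :=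
  ⨅ (f : Fin k ↪o ℕ) (g : Fin k ↪o ℕ), (M.submatrix f g).det.order

/-- The region on and above the Newton polygon, i.e. on and above the lower convex hull of the
points `(k, N(M, k))` with `N(M, k) < ∞`. -/
def newtonRegion (M : Matrix ℕ ℕ (PowerSeries K)) : Set (ℝ × ℝ) :=
  convexHull ℝ {q | ∃ k n : ℕ, newtonFunction M k = n ∧ q.1 = k ∧ (n : ℝ) ≤ q.2}

/-- `k` is a touching vertex of `M`: the point `(k, N(M, k))` is a vertex of the Newton polygon
of `M`, and `N(M, k) = H(M, k)`. -/
def IsTouchingVertex (M : Matrix ℕ ℕ (PowerSeries K)) (k : ℕ) : Prop :=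
  (∃ n : ℕ, newtonFunction M k = n ∧ ((k : ℝ), (n : ℝ)) ∈ (newtonRegion M).extremePoints ℝ) ∧
    newtonFunction M k = hodgeFunction M k

end PowerSeriesMatrices

section Ring

variable {R : Type*} [Ring R]

/-- `R` is complete (and separated) for the `J`-adic topology: the canonical map from `R` to the
inverse limit of the `R / J ^ n` is injective and surjective. Here `J` is a two-sided ideal of a
possibly noncommutative ring. -/
def IsCompleteAdic (J : Ideal R) : Prop :=
  (∀ x : R, (∀ n : ℕ, x ∈ J ^ n) → x = 0) ∧
    ∀ x : ℕ → R, (∀ n : ℕ, x (n + 1) - x n ∈ J ^ n) → ∃ y : R, ∀ n : ℕ, y - x n ∈ J ^ n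

/-- The sequence `u` converges to `x` in the `J`-adic topology. -/
def AdicTendsto (J : Ideal R) (u : ℕ → R) (x : R) : Prop :=
  ∀ n : ℕ, ∀ᶠ k in atTop, u k - x ∈ J ^ n

/-- `C = A B` for infinite matrices: for all `i, j` the series `∑ₖ A i k * B k j` converges
`J`-adically, with sum `C i j`. -/
def IsMatProd (J : Ideal R) (A B C : Matrix ℕ ℕ R) : Prop :=
  ∀ i j, AdicTendsto J (fun n => ∑ k ∈ Finset.range n, A i k * B k j) (C i j)

/-- The columns of `A` tend to zero `J`-adically. Such matrices form a ring under
multiplication of matrices. -/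
def IsColumnNull (J : Ideal R) (A : Matrix ℕ ℕ R) : Prop :=
  ∀ j, AdicTendsto J (fun i => A i j) 0

/-- `Q` is an invertible infinite matrix with inverse `Q'`: both are elements of the ring of
matrices whose columns tend to zero, and they are two-sided inverses of each other there. -/
def IsInversePair (J : Ideal R) (Q Q' : Matrix ℕ ℕ R) : Prop :=
  IsColumnNull J Q ∧ IsColumnNull J Q' ∧ IsMatProd J Q Q' 1 ∧ IsMatProd J Q' Q 1

/-- `M` is `lam`-Hodge bounded with respect to `T`: `M = Diag(T ^ lam 0, T ^ lam 1, …) M'` for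
some matrix `M'`. -/
def IsHodgeBounded (T : R) (lam : ℕ → ℕ) (M : Matrix ℕ ℕ R) : Prop :=
  ∃ M' : Matrix ℕ ℕ R, ∀ i j, M i j = T ^ lam i * M' i j

/-- `A` is `lam`-stable with respect to `T`: for every `lam`-Hodge bounded matrix `B` the product
`A B` is `lam`-Hodge bounded as well. -/
def IsStable (J : Ideal R) (T : R) (lam : ℕ → ℕ) (A : Matrix ℕ ℕ R) : Prop :=
  ∀ B : Matrix ℕ ℕ R, IsHodgeBounded T lam B →
    ∃ C : Matrix ℕ ℕ R, IsMatProd J A B C ∧ IsHodgeBounded T lam C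

end Ring

/-- The series defining the Newton function of a Hodge bounded matrix converges: for each `n` only
finitely many principal `k × k` minors contribute to the coefficient of `T ^ n`. -/
theorem finite_support_coeff_minor {K : Type*} [CommRing K] {lam : ℕ → ℕ}
    (hlam : Tendsto lam atTop atTop) {M : Matrix ℕ ℕ (PowerSeries K)}
    (hM : IsHodgeBounded (PowerSeries.X : PowerSeries K) lam M) (k n : ℕ) :
    (Function.support fun f : Fin k ↪o ℕ =>
      PowerSeries.coeff n (M.submatrix f f).det).Finite := by
  obtain ⟨M', hM'⟩ := hM
  obtain ⟨N, hN⟩ := (hlam.eventually (eventually_gt_atTop n)).exists_forall_of_atTop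
  have hinj : Function.Injective
      (fun (f : Fin k ↪o ℕ) => (fun i => f i : Fin k → ℕ)) := DFunLike.coe_injective
  refine Set.Finite.subset (Set.Finite.preimage hinj.injOn
    (Set.Finite.pi fun _ : Fin k => Set.finite_lt_nat N)) ?_
  intro f hf
  simp only [Set.mem_preimage, Set.mem_pi, Set.mem_ofPred_eq]
  intro i _
  by_contra hi
  apply hf
  have hdet : (PowerSeries.X : PowerSeries K) ^ lam (f i) ∣ (M.submatrix f f).det := by
    rw [Matrix.det_apply]
    refine Finset.dvd_sum fun σ _ => ?_
    rw [Units.smul_def, zsmul_eq_mul]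
    refine Dvd.dvd.mul_left ?_ _
    refine Dvd.dvd.trans ?_ (Finset.dvd_prod_of_mem _ (Finset.mem_univ (σ.symm i)))
    simp [hM']
  exact PowerSeries.X_pow_dvd_iff.mp hdet n (hN _ (not_lt.mp hi))

end NewtonHodge

end

open NewtonHodge

/-! Write `M = Diag(T ^ lam) M'` and let `s` be the first touching vertex. Conjugation by `1 - X`,
where `X` is supported in rows `≥ s` and columns `< s` with entries `T ^ (lam i - lam j) * Z i j`,
preserves Hodge boundedness. It kills the lower left block as soon as `Z` is a fixed point of the
Riccati map `Z ↦ (M'₁ + M' X₁ - Z (M' X₁)₁₁) K`. Here `M'₁` and `X₁` consist of the first `s`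
columns, the index `11` marks the leading `s × s` block, and `K` inverts `M'₁₁`.

If `lam` jumps strictly at `s`, every entry of `X` carries a factor `T`, so the map is contracting
once `M'₁₁` is invertible. In general let `[a, b)` be the maximal interval on which `lam = lam (s -
1)`. Rows in `[s, b)` and columns in `[a, s)` gain no factor `T`, and to leading order the map acts
on those rows by `D ↦ B D (E K)`, where `B` is the block of `M'` on `[s, b)` and `E` the projector
to `[a, s)`. If `B` or `E K` is nilpotent modulo `J`, and the lower left entries of `M'` in rows
`[s, b)` lie in `J`, some iterate contracts (`exists_riccatiMap_fixedPoint`).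

These conditions are arranged over the residue field, for the `b × b` reduction `A` of `M'`. The
pencil `A + X E`, now with `E` the projector to indices `≥ a` and `X` a variable, has as determinant
a polynomial whose coefficient at `X ^ (b - k)` is the coefficient of `principalMinorSum` at the
Hodge height of `k` (`coeff_principalMinorSum`). It is nonzero at `k = s`. Since the Hodge polygon
is straight over `[a, b]`, extremality at `s` makes `X ^ (b - s)` either the lowest or the highest
term (`coeff_det_pencil_of_vertex`).

If the leading `a × a` block of `A` were invertible, its Schur complement would have a Fitting
decomposition giving the required base change. As it may be singular, the Schur complement is
replaced by the linear relation `relStep`, iterated from the whole tail space (lowest term) or from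
zero (highest term). The stable subspace becomes a coordinate subspace, and the pencil shows that
its dimension is `s - a` (`exists_goodForm`). The base change lifts to `R` compatibly with `Diag(T ^
lam)` (`exists_lift_conjugation`). -/

namespace NewtonHodge

open scoped Topology

set_option linter.unusedSectionVars false

/-! ### The `J`-adic topology as a complete nonarchimedean ring topology -/

section AdicTopology

variable {R : Type*} [Ring R]

theorem ringSubgroupsBasis_pow (J : Ideal R) [J.IsTwoSided] :
    RingSubgroupsBasis fun n : ℕ => (J ^ n).toAddSubgroup where
  inter i j := ⟨max i j, le_inf (Ideal.pow_le_pow_right (le_max_left i j))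
    (Ideal.pow_le_pow_right (le_max_right i j))⟩
  mul i := ⟨i, by
    rintro _ ⟨x, -, y, hy, rfl⟩
    exact (J ^ i).mul_mem_left x hy⟩
  leftMul x i := ⟨i, fun y hy => (J ^ i).mul_mem_left x hy⟩
  rightMul x i := ⟨i, fun y hy => (J ^ i).mul_mem_right x hy⟩

/-- The topology of a topological ring is the `J`-adic one. -/
def IsAdicTopology [TopologicalSpace R] (J : Ideal R) : Prop :=
  (𝓝 (0 : R)).HasBasis (fun _ : ℕ => True) fun n => ((J ^ n : Ideal R) : Set R)

theorem IsAdicTopology.tendsto_zero_iff [TopologicalSpace R] {J : Ideal R} (h : IsAdicTopology J)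
    {ι : Type*} {l : Filter ι} {u : ι → R} :
    Tendsto u l (𝓝 0) ↔ ∀ n, ∀ᶠ k in l, u k ∈ J ^ n := by
  simp [HasBasis.tendsto_right_iff h]

theorem IsAdicTopology.adicTendsto_iff [TopologicalSpace R] [IsTopologicalRing R] {J : Ideal R}
    (h : IsAdicTopology J) {u : ℕ → R} {x : R} : AdicTendsto J u x ↔ Tendsto u atTop (𝓝 x) := by
  rw [← tendsto_sub_nhds_zero_iff, h.tendsto_zero_iff]
  rfl

theorem IsAdicTopology.isClosed_pow [TopologicalSpace R] [IsTopologicalRing R] {J : Ideal R}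
    (h : IsAdicTopology J) (n : ℕ) : IsClosed ((J ^ n : Ideal R) : Set R) := by
  have hopen : IsOpen (((J ^ n).toAddSubgroup : AddSubgroup R) : Set R) :=
    AddSubgroup.isOpen_of_mem_nhds (g := 0) _ (h.mem_of_mem trivial)
  exact AddSubgroup.isClosed_of_isOpen _ hopen

theorem IsAdicTopology.nonarchimedeanRing [TopologicalSpace R] [IsTopologicalRing R] {J : Ideal R}
    (h : IsAdicTopology J) : NonarchimedeanRing R where
  is_nonarchimedean U hU := by
    obtain ⟨n, -, hn⟩ := h.mem_iff.mp hU
    exact ⟨⟨(J ^ n).toAddSubgroup,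
      AddSubgroup.isOpen_of_mem_nhds (g := 0) _ (h.mem_of_mem trivial)⟩, hn⟩

theorem IsAdicTopology.t2Space [TopologicalSpace R] [IsTopologicalRing R] {J : Ideal R}
    (h : IsAdicTopology J) (hc : IsCompleteAdic J) : T2Space R := by
  refine IsTopologicalAddGroup.t2Space_of_zero_sep fun x hx => ?_
  by_contra hcon
  push Not at hcon
  exact hx (hc.1 x fun n => hcon _ (h.mem_of_mem trivial))

theorem IsAdicTopology.completeSpace [UniformSpace R] [IsUniformAddGroup R] [IsTopologicalRing R]
    {J : Ideal R} (h : IsAdicTopology J) (hc : IsCompleteAdic J) : CompleteSpace R := by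
  have : (𝓝 (0 : R)).IsCountablyGenerated := h.isCountablyGenerated
  have : (uniformity R).IsCountablyGenerated := by
    rw [uniformity_eq_comap_nhds_zero R]
    infer_instance
  refine UniformSpace.complete_of_cauchySeq_tendsto fun u hu => ?_
  have hu' : ∀ n, ∃ N, ∀ i ≥ N, ∀ j ≥ N, u j - u i ∈ J ^ n := by
    intro n
    have hmem : {q : R × R | q.2 - q.1 ∈ J ^ n} ∈ uniformity R := by
      rw [uniformity_eq_comap_nhds_zero R]
      exact ⟨_, h.mem_of_mem (i := n) trivial, fun _ => id⟩
    obtain ⟨N, hN⟩ := (cauchySeq_iff.mp hu) _ hmem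
    exact ⟨N, fun i hi j hj => hN i hi j hj⟩
  choose N hN using hu'
  -- Summing the Cauchy moduli gives an index beyond `N m` for every `m ≤ n` at once.
  let φ : ℕ → ℕ := fun n => ∑ i ∈ Finset.range (n + 1), N i
  have hφ : ∀ m n, m ≤ n → N m ≤ φ n := fun m n hmn =>
    Finset.single_le_sum (f := N) (fun _ _ => Nat.zero_le _) (by simp; omega)
  obtain ⟨y, hy⟩ := hc.2 (fun n => u (φ n)) fun n =>
    hN n _ (hφ n n le_rfl) _ (hφ n (n + 1) (Nat.le_succ n))
  refine ⟨y, h.adicTendsto_iff.mp fun n => ?_⟩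
  filter_upwards [eventually_ge_atTop (N n)] with k hk
  have := (J ^ n).sub_mem (hN n _ (hφ n n le_rfl) k hk) (hy n)
  simpa using this

end AdicTopology

/-! ### Products of infinite matrices -/

section InfiniteProducts

variable {R : Type*} [Ring R]

/-- The product of two matrices, the first with infinitely many columns, the second with infinitely
many rows. -/
noncomputable def infMul [TopologicalSpace R] {m n : Type*} (A : Matrix m ℕ R) (B : Matrix ℕ n R) :
    Matrix m n R :=
  fun i j => ∑' k, A i k * B k j

/-- The columns tend to zero. -/
def ColNull [TopologicalSpace R] {n : Type*} (A : Matrix ℕ n R) : Prop :=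
  ∀ j, Tendsto (fun i => A i j) atTop (𝓝 0)

variable {J : Ideal R} {m n : Type*}

section Basic

variable [TopologicalSpace R] [IsTopologicalRing R]

theorem ColNull.add {A B : Matrix ℕ n R} (hA : ColNull A) (hB : ColNull B) : ColNull (A + B) :=
  fun j => by simpa using (hA j).add (hB j)

theorem ColNull.sub {A B : Matrix ℕ n R} (hA : ColNull A) (hB : ColNull B) : ColNull (A - B) :=
  fun j => by simpa using (hA j).sub (hB j)

theorem ColNull.one : ColNull (1 : Matrix ℕ ℕ R) := fun j =>
  tendsto_const_nhds.congr' <| (eventually_gt_atTop j).mono fun i hi => by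
    simp [hi.ne']

theorem infMul_one (A : Matrix m ℕ R) : infMul A 1 = A := by
  ext i j
  rw [infMul, tsum_eq_single j]
  · simp
  · intro k hk
    simp [hk]

theorem one_infMul (A : Matrix ℕ n R) : infMul 1 A = A := by
  ext i j
  rw [infMul, tsum_eq_single i]
  · simp
  · intro k hk
    simp [hk.symm]

theorem infMul_mem (hJ : IsAdicTopology J) (A : Matrix m ℕ R) {B : Matrix ℕ n R} {k : ℕ} {j : n}
    (hB : ∀ l, B l j ∈ J ^ k) (i : m) : infMul A B i j ∈ J ^ k :=
  tsum_mem (s := (J ^ k).toAddSubgroup) (hJ.isClosed_pow k) fun l =>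
    (J ^ k).mul_mem_left _ (hB l)

end Basic

variable [UniformSpace R] [IsUniformAddGroup R] [NonarchimedeanRing R] [CompleteSpace R]
  [T2Space R]

theorem summable_infMul (hJ : IsAdicTopology J) (A : Matrix m ℕ R) {B : Matrix ℕ n R}
    (hB : ColNull B) (i : m) (j : n) : Summable fun k => A i k * B k j := by
  refine NonarchimedeanAddGroup.summable_of_tendsto_cofinite_zero ?_
  rw [Nat.cofinite_eq_atTop, hJ.tendsto_zero_iff]
  intro N
  filter_upwards [hJ.tendsto_zero_iff.mp (hB j) N] with k hk
  exact (J ^ N).mul_mem_left _ hk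

theorem isMatProd_infMul (hJ : IsAdicTopology J) (A : Matrix ℕ ℕ R) {B : Matrix ℕ ℕ R}
    (hB : ColNull B) : IsMatProd J A B (infMul A B) := fun i j =>
  hJ.adicTendsto_iff.mpr (summable_infMul hJ A hB i j).hasSum.tendsto_sum_nat

theorem infMul_add (hJ : IsAdicTopology J) (A : Matrix m ℕ R) {B C : Matrix ℕ n R}
    (hB : ColNull B) (hC : ColNull C) : infMul A (B + C) = infMul A B + infMul A C := by
  ext i j
  simp only [infMul, Matrix.add_apply, mul_add]
  exact (summable_infMul hJ A hB i j).tsum_add (summable_infMul hJ A hC i j)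

theorem infMul_sub (hJ : IsAdicTopology J) (A : Matrix m ℕ R) {B C : Matrix ℕ n R}
    (hB : ColNull B) (hC : ColNull C) : infMul A (B - C) = infMul A B - infMul A C := by
  ext i j
  simp only [infMul, Matrix.sub_apply, mul_sub]
  exact (summable_infMul hJ A hB i j).tsum_sub (summable_infMul hJ A hC i j)

theorem add_infMul (hJ : IsAdicTopology J) (A B : Matrix m ℕ R) {C : Matrix ℕ n R}
    (hC : ColNull C) : infMul (A + B) C = infMul A C + infMul B C := by
  ext i j
  simp only [infMul, Matrix.add_apply, add_mul]
  exact (summable_infMul hJ A hC i j).tsum_add (summable_infMul hJ B hC i j)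

theorem sub_infMul (hJ : IsAdicTopology J) (A B : Matrix m ℕ R) {C : Matrix ℕ n R}
    (hC : ColNull C) : infMul (A - B) C = infMul A C - infMul B C := by
  ext i j
  simp only [infMul, Matrix.sub_apply, sub_mul]
  exact (summable_infMul hJ A hC i j).tsum_sub (summable_infMul hJ B hC i j)

theorem colNull_infMul [J.IsTwoSided] (hJ : IsAdicTopology J) {A : Matrix ℕ ℕ R}
    {B : Matrix ℕ n R} (hA : ColNull A) (hB : ColNull B) :
    ColNull (infMul A B) := by
  intro j
  rw [hJ.tendsto_zero_iff]
  intro N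
  obtain ⟨K, hK⟩ := (hJ.tendsto_zero_iff.mp (hB j) N).exists_forall_of_atTop
  have h := (Filter.eventually_all_finset (Finset.range K)).mpr fun k _ =>
    hJ.tendsto_zero_iff.mp (hA k) N
  filter_upwards [h] with i hi
  refine tsum_mem (s := (J ^ N).toAddSubgroup) (hJ.isClosed_pow N) fun k => ?_
  by_cases hk : k < K
  · exact (J ^ N).mul_mem_right _ (hi k (by simpa using hk))
  · exact (J ^ N).mul_mem_left _ (hK k (not_lt.mp hk))

/-- Fubini for the double series. Its terms tend to zero along the cofinite filter: `C l j` is small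
for all large `l`, and for each of the finitely many other `l` the column `B · l` is small for large
`k`. -/
theorem infMul_assoc [J.IsTwoSided] (hJ : IsAdicTopology J) (A : Matrix m ℕ R)
    {B : Matrix ℕ ℕ R} {C : Matrix ℕ n R} (hB : ColNull B) (hC : ColNull C) :
    infMul (infMul A B) C =
      infMul A (infMul B C) := by
  ext i j
  simp only [infMul]
  have hsum : Summable (Function.uncurry fun k l => A i k * B k l * C l j) := by
    refine NonarchimedeanAddGroup.summable_of_tendsto_cofinite_zero ?_
    rw [hJ.tendsto_zero_iff]
    intro N
    obtain ⟨L, hL⟩ := (hJ.tendsto_zero_iff.mp (hC j) N).exists_forall_of_atTop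
    obtain ⟨K, hK⟩ := ((Filter.eventually_all_finset (Finset.range L)).mpr fun l _ =>
      hJ.tendsto_zero_iff.mp (hB l) N).exists_forall_of_atTop
    refine ((Finset.range K ×ˢ Finset.range L).finite_toSet).subset fun q hq => ?_
    by_contra hcon
    refine hq ?_
    by_cases hl : q.2 < L
    · have hk : K ≤ q.1 := by
        by_contra hk
        exact hcon (by simp [hl, not_le.mp hk])
      exact (J ^ N).mul_mem_right _ ((J ^ N).mul_mem_left _ (hK _ hk _ (by simpa using hl)))
    · exact (J ^ N).mul_mem_left _ (hL _ (not_lt.mp hl))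
  have h1 : ∀ l, (∑' k, A i k * B k l) * C l j = ∑' k, A i k * B k l * C l j := fun l =>
    ((summable_infMul hJ A hB i l).tsum_mul_right _).symm
  have h2 : ∀ k, A i k * ∑' l, B k l * C l j = ∑' l, A i k * B k l * C l j := fun k => by
    simp_rw [mul_assoc]
    exact ((summable_infMul hJ B hC k j).tsum_mul_left _).symm
  simp_rw [h1, h2]
  exact hsum.tsum_comm

end InfiniteProducts

/-- A map on a complete filtered group, some iterate of which is contracting, has a fixed point. -/
theorem exists_fixedPoint {G : Type*} [AddCommGroup G] (F : ℕ → AddSubgroup G) (hF : Antitone F)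
    (hF0 : F 0 = ⊤) (hsep : ∀ x, (∀ n, x ∈ F n) → x = 0)
    (hcomplete : ∀ x : ℕ → G, (∀ n, x (n + 1) - x n ∈ F n) → ∃ y, ∀ n, y - x n ∈ F n)
    (S : AddSubgroup G) (hS : F 1 ≤ S) (Φ : G → G) (hΦ : ∀ x ∈ S, Φ x ∈ S)
    (K : ℕ)
    (hlt : ∀ m, ∀ x ∈ S, ∀ y ∈ S, x - y ∈ F m → Φ^[K] x - Φ^[K] y ∈ F (m + 1)) :
    ∃ x ∈ S, Φ x = x := by
  have hiter : ∀ n, ∀ x ∈ S, Φ^[n] x ∈ S := by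
    intro n
    induction n with
    | zero => simp
    | succ n ih => exact fun x hx => by rw [Function.iterate_succ_apply]; exact ih _ (hΦ x hx)
  have hiter' : ∀ n, ∀ x ∈ S, (Φ^[K])^[n] x ∈ S := fun n x hx => by
    rw [← Function.iterate_mul]; exact hiter _ x hx
  have hcontr : ∀ n, ∀ x ∈ S, ∀ y ∈ S, (Φ^[K])^[n] x - (Φ^[K])^[n] y ∈ F n := by
    intro n
    induction n with
    | zero => simp [hF0]
    | succ n ih =>
      intro x hx y hy
      rw [Function.iterate_succ_apply', Function.iterate_succ_apply']
      exact hlt n _ (hiter' n x hx) _ (hiter' n y hy) (ih x hx y hy)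
  obtain ⟨y, hy⟩ := hcomplete (fun n => (Φ^[K])^[n] 0) fun n => by
    simp only [Function.iterate_succ_apply]
    exact hcontr n _ (hiter K 0 S.zero_mem) 0 S.zero_mem
  -- Nothing makes `S` closed a priori, but `y` agrees with an element of `S` modulo `F 1 ≤ S`.
  have hyS : y ∈ S := by
    have := S.add_mem (hS (hy 1)) (hiter' 1 0 S.zero_mem)
    simpa using this
  have hfix : Φ^[K] y = y := by
    rw [← sub_eq_zero]
    refine hsep _ fun n => ?_
    have h1 := hF (Nat.le_succ n) (hlt n y hyS _ (hiter' n 0 S.zero_mem) (hy n))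
    have h2 := hF (Nat.le_succ n) (hy (n + 1))
    simp only [Function.iterate_succ_apply'] at h2
    simpa using (F n).sub_mem h1 h2
  refine ⟨y, hyS, ?_⟩
  rw [← sub_eq_zero]
  refine hsep _ fun n => ?_
  -- `Φ y` and `y` are both fixed by the contracting iterate, hence equal.
  have h := hcontr n _ (hΦ y hyS) y hyS
  have hcomm : (Φ^[K])^[n] (Φ y) = Φ ((Φ^[K])^[n] y) := by
    rw [← Function.iterate_mul, ← Function.iterate_succ_apply, Function.iterate_succ_apply']
  rw [hcomm] at h
  rwa [Function.iterate_fixed hfix] at h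

/-! ### Finite matrices modulo powers of `J` -/

section Entries

variable {R : Type*} [Ring R] {l m n : Type*}

/-- The matrices all of whose entries lie in a given ideal. -/
def entriesIn (m n : Type*) (I : Ideal R) : AddSubgroup (Matrix m n R) where
  carrier := {A | ∀ i j, A i j ∈ I}
  add_mem' hA hB i j := I.add_mem (hA i j) (hB i j)
  zero_mem' _ _ := I.zero_mem
  neg_mem' hA i j := I.neg_mem (hA i j)

theorem mem_entriesIn {I : Ideal R} {A : Matrix m n R} :
    A ∈ entriesIn m n I ↔ ∀ i j, A i j ∈ I := Iff.rfl

theorem mul_row_mem_left [Fintype m] {I : Ideal R} (A : Matrix l m R) {B : Matrix m n R}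
    (hB : B ∈ entriesIn m n I) : A * B ∈ entriesIn l n I := fun i j =>
  I.sum_mem fun k _ => I.mul_mem_left _ (hB k j)

theorem mul_apply_mem_right [Fintype m] {I : Ideal R} [I.IsTwoSided] {A : Matrix l m R}
    {i : l} (hA : ∀ k, A i k ∈ I) (B : Matrix m n R) (j : n) : (A * B) i j ∈ I :=
  I.sum_mem fun k _ => I.mul_mem_right _ (hA k)

theorem mul_mem_entriesIn_right [Fintype m] {I : Ideal R} [I.IsTwoSided] {A : Matrix l m R}
    (hA : A ∈ entriesIn l m I) (B : Matrix m n R) : A * B ∈ entriesIn l n I := fun i j =>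
  mul_apply_mem_right (hA i) B j

theorem mul_apply_mem_pow_add [Fintype m] {J : Ideal R} [J.IsTwoSided] {A : Matrix l m R} {B : Matrix m n R}
    {i : l} {j : n} {p q : ℕ} (hA : ∀ k, A i k ∈ J ^ p) (hB : ∀ k, B k j ∈ J ^ q) :
    (A * B) i j ∈ J ^ (p + q) := by
  rw [Ideal.IsTwoSided.pow_add]
  exact Ideal.sum_mem _ fun k _ => Ideal.mul_mem_mul (hA k) (hB k)

variable {J : Ideal R}

theorem entriesIn_pow_antitone : Antitone fun k => entriesIn m n (J ^ k) :=
  fun _ _ h _ hA i j => Ideal.pow_le_pow_right h (hA i j)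

theorem entriesIn_pow_zero : entriesIn m n (J ^ 0) = ⊤ := by
  ext A
  simp [mem_entriesIn, Submodule.pow_zero, Ideal.one_eq_top]

theorem eq_zero_of_forall_mem_entriesIn (hc : IsCompleteAdic J) (A : Matrix m n R)
    (hA : ∀ k, A ∈ entriesIn m n (J ^ k)) : A = 0 := by
  ext i j
  exact hc.1 _ fun k => hA k i j

theorem exists_entriesIn_limit (hc : IsCompleteAdic J) (x : ℕ → Matrix m n R)
    (hx : ∀ k, x (k + 1) - x k ∈ entriesIn m n (J ^ k)) :
    ∃ y, ∀ k, y - x k ∈ entriesIn m n (J ^ k) := by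
  have h : ∀ i j, ∃ y : R, ∀ k, y - x k i j ∈ J ^ k := fun i j => hc.2 (fun k => x k i j)
    fun k => hx k i j
  choose y hy using h
  exact ⟨fun i j => y i j, fun k i j => hy i j k⟩

/-- The map `Y ↦ 1 - Z * Y` is contracting, which gives right inverses. The right inverse is again
congruent to `1` modulo `J`, so it has a right inverse of its own, and the two inverses become
two-sided. -/
theorem exists_inverse_one_add [J.IsTwoSided] [Fintype n] [DecidableEq n] (hc : IsCompleteAdic J)
    {Z : Matrix n n R} (hZ : Z ∈ entriesIn n n J) : ∃ Y, (1 + Z) * Y = 1 ∧ Y * (1 + Z) = 1 := by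
  have key : ∀ Z ∈ entriesIn n n J, ∃ Y, (1 + Z) * Y = 1 := by
    intro Z hZ
    obtain ⟨Y, -, hY⟩ := exists_fixedPoint (fun k => entriesIn n n (J ^ k)) entriesIn_pow_antitone
      entriesIn_pow_zero (eq_zero_of_forall_mem_entriesIn hc) (exists_entriesIn_limit hc) ⊤ le_top
      (fun Y => 1 - Z * Y) (fun _ _ => trivial)
      1
      (fun m x _ y _ h i j => by
        have : 1 - Z * x - (1 - Z * y) = -(Z * (x - y)) := by noncomm_ring
        simp only [Function.iterate_one, this]
        rw [add_comm]
        exact neg_mem (mul_apply_mem_pow_add (by simpa [Submodule.pow_one] using hZ i) fun k => h k j))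
    refine ⟨Y, ?_⟩
    rw [add_mul, one_mul]
    nth_rewrite 1 [← hY]
    simp
  obtain ⟨Y, hY⟩ := key Z hZ
  have hY1 : Y - 1 ∈ entriesIn n n J := by
    have : Y - 1 = -(Z * Y) := by rw [← hY]; noncomm_ring
    rw [this]
    exact neg_mem (mul_mem_entriesIn_right hZ Y)
  obtain ⟨W, hW⟩ := key _ hY1
  rw [add_sub_cancel] at hW
  refine ⟨Y, hY, ?_⟩
  rwa [left_inv_eq_right_inv hY hW]

/-- An arbitrary lift of the inverse is an inverse up to factors congruent to `1` modulo `J`, and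
these are invertible. -/
theorem exists_inverse_of_map [J.IsTwoSided] {F : Type*} [Ring F] [Fintype n] [DecidableEq n]
    (hc : IsCompleteAdic J) {ρ : R →+* F} (hρ : Function.Surjective ρ)
    (hker : ∀ x, ρ x = 0 ↔ x ∈ J)
    {A : Matrix n n R} {B : Matrix n n F} (h1 : A.map ρ * B = 1) (h2 : B * A.map ρ = 1) :
    ∃ K, A * K = 1 ∧ K * A = 1 ∧ K.map ρ = B := by
  obtain ⟨B', rfl⟩ : ∃ B' : Matrix n n R, B'.map ρ = B := by
    choose g hg using hρ
    exact ⟨B.map g, by ext; simp [hg]⟩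
  have hlift : ∀ C : Matrix n n R, C.map ρ = 1 → ∃ Y, C * Y = 1 ∧ Y * C = 1 := by
    intro C hC
    obtain ⟨Y, hY⟩ := exists_inverse_one_add hc (Z := C - 1) fun i j => by
      rw [← hker, Matrix.sub_apply, map_sub, ← Matrix.map_apply (f := ρ), hC]
      by_cases hij : i = j
      · subst hij; simp
      · simp [hij]
    exact ⟨Y, by simpa using hY⟩
  obtain ⟨Y, hY, -⟩ := hlift (A * B') (by rw [Matrix.map_mul, h1])
  obtain ⟨W, -, hW⟩ := hlift (B' * A) (by rw [Matrix.map_mul, h2])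
  have hr : A * (B' * Y) = 1 := by rw [← mul_assoc, hY]
  have hl : W * B' * A = 1 := by rw [mul_assoc, hW]
  have heq : W * B' = B' * Y := left_inv_eq_right_inv hl hr
  refine ⟨B' * Y, hr, heq ▸ hl, ?_⟩
  have := congrArg (fun M : Matrix n n R => M.map ρ) hr
  rw [Matrix.map_mul, Matrix.map_one _ (map_zero ρ) (map_one ρ)] at this
  exact (left_inv_eq_right_inv h2 this).symm

end Entries

/-! ### Conjugation by `Diag(T ^ lam)` on lower left blocks -/

section Twist

variable {R : Type*} [Ring R] {J : Ideal R} {T : R} {lam : ℕ → ℕ} {s : ℕ}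

/-- The rows from `s` on of `Diag(T ^ lam) Z Diag(T ^ lam)⁻¹`. -/
def twist (T : R) (lam : ℕ → ℕ) {s : ℕ} (Z : Matrix ℕ (Fin s) R) : Matrix ℕ (Fin s) R :=
  fun i j => if s ≤ i then T ^ (lam i - lam j) * Z i j else 0

theorem twist_apply_of_lt {Z : Matrix ℕ (Fin s) R} {i : ℕ} (hi : i < s) (j : Fin s) :
    twist T lam Z i j = 0 := if_neg (not_le.mpr hi)

theorem twist_sub (Z W : Matrix ℕ (Fin s) R) :
    twist T lam (Z - W) = twist T lam Z - twist T lam W := by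
  ext i j
  by_cases hi : s ≤ i <;> simp [twist, hi, mul_sub]

theorem pow_mem_pow (hT : T ∈ J) (n : ℕ) : T ^ n ∈ J ^ n := Ideal.pow_mem_pow hT n

theorem twist_mem {Z : Matrix ℕ (Fin s) R} {i : ℕ} {j : Fin s} {I : Ideal R} (h : Z i j ∈ I) :
    twist T lam Z i j ∈ I := by
  unfold twist
  split_ifs
  · exact I.mul_mem_left _ h
  · exact I.zero_mem

theorem twist_mem_succ [J.IsTwoSided] (hT : T ∈ J) {Z : Matrix ℕ (Fin s) R} {i : ℕ} {j : Fin s}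
    {m : ℕ} (hlt : s ≤ i → lam j < lam i) (h : Z i j ∈ J ^ m) :
    twist T lam Z i j ∈ J ^ (m + 1) := by
  unfold twist
  split_ifs with hi
  · rw [add_comm, Ideal.IsTwoSided.pow_add]
    refine Ideal.mul_mem_mul ?_ h
    exact Ideal.pow_le_pow_right (Nat.sub_pos_of_lt (hlt hi)) (pow_mem_pow hT _)
  · exact Ideal.zero_mem _

theorem colNull_twist [TopologicalSpace R] [J.IsTwoSided] (hJ : IsAdicTopology J) (hT : T ∈ J)
    (hlam : Tendsto lam atTop atTop) (Z : Matrix ℕ (Fin s) R) : ColNull (twist T lam Z) := by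
  intro j
  rw [hJ.tendsto_zero_iff]
  intro n
  filter_upwards [hlam.eventually_ge_atTop (n + lam j)] with i hi
  unfold twist
  split_ifs
  · exact (J ^ n).mul_mem_right _ (Ideal.pow_le_pow_right (by omega) (pow_mem_pow hT _))
  · exact Ideal.zero_mem _

end Twist

/-! ### Contraction properties of the Riccati map -/

section Riccati

variable {R : Type*} [Ring R] [UniformSpace R] [IsUniformAddGroup R] [NonarchimedeanRing R]
  [CompleteSpace R] [T2Space R] {J : Ideal R} [J.IsTwoSided] {T : R} {lam : ℕ → ℕ} {s : ℕ}

/-- The map whose fixed points `Z` give the lower triangular unipotent matrices conjugating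
`Diag(T ^ lam) M'` to a block upper triangular matrix. -/
noncomputable def riccatiMap (T : R) (lam : ℕ → ℕ) (M' : Matrix ℕ ℕ R)
    (K : Matrix (Fin s) (Fin s) R) (Z : Matrix ℕ (Fin s) R) : Matrix ℕ (Fin s) R :=
  (M'.submatrix id (Fin.val : Fin s → ℕ) + infMul M' (twist T lam Z) -
    Z * (infMul M' (twist T lam Z)).submatrix (Fin.val : Fin s → ℕ) id) * K

theorem riccatiMap_sub (hJ : IsAdicTopology J) (hT : T ∈ J) (hlam : Tendsto lam atTop atTop)
    (M' : Matrix ℕ ℕ R) (K : Matrix (Fin s) (Fin s) R) (Z W : Matrix ℕ (Fin s) R) :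
    riccatiMap T lam M' K Z - riccatiMap T lam M' K W =
      (infMul M' (twist T lam (Z - W)) -
        (Z - W) * (infMul M' (twist T lam Z)).submatrix (Fin.val : Fin s → ℕ) id -
        W * (infMul M' (twist T lam (Z - W))).submatrix (Fin.val : Fin s → ℕ) id) * K := by
  have h := infMul_sub hJ M' (colNull_twist hJ hT hlam Z) (colNull_twist hJ hT hlam W)
  rw [← twist_sub] at h
  simp only [riccatiMap, h, Matrix.submatrix_sub, Pi.sub_apply, Matrix.mul_sub, Matrix.sub_mul,
    Matrix.add_mul]
  abel

variable {a b : ℕ} {M' : Matrix ℕ ℕ R} {K : Matrix (Fin s) (Fin s) R}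

/-- The square block of `M'` with rows and columns in `[s, b)`. -/
def cornerBlock {R : Type*} [Zero R] (M' : Matrix ℕ ℕ R) (s b : ℕ) : Matrix (Fin b) (Fin b) R :=
  fun i k => if s ≤ i ∧ s ≤ k then M' i k else 0

/-- The diagonal projector to the indices `≥ a`. -/
def tailProj (R : Type*) [Ring R] (a s : ℕ) : Matrix (Fin s) (Fin s) R :=
  Matrix.diagonal fun i => if a ≤ i then 1 else 0

/-- The set of matrices whose rows in `[s, b)` have entries in `J`. -/
def rowsIn (J : Ideal R) (s b : ℕ) : AddSubgroup (Matrix ℕ (Fin s) R) where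
  carrier := {A | ∀ i j, s ≤ i → i < b → A i j ∈ J}
  add_mem' hA hB _ _ h1 h2 := J.add_mem (hA _ _ h1 h2) (hB _ _ h1 h2)
  zero_mem' _ _ _ _ := J.zero_mem
  neg_mem' hA _ _ h1 h2 := J.neg_mem (hA _ _ h1 h2)

theorem twist_mem_of_rowsIn (hT : T ∈ J) {Z : Matrix ℕ (Fin s) R}
    (hb : ∀ (i : ℕ) (j : Fin s), b ≤ i → s ≤ i → lam j < lam i) (hZ : Z ∈ rowsIn J s b)
    (i : ℕ) (j : Fin s) : twist T lam Z i j ∈ J := by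
  by_cases hi : s ≤ i
  · by_cases hib : i < b
    · exact twist_mem (hZ i j hi hib)
    · have := twist_mem_succ (m := 0) hT (fun h => hb i j (not_lt.mp hib) h)
        (by simp [Submodule.pow_zero, Ideal.one_eq_top] : Z i j ∈ J ^ 0)
      simpa [Submodule.pow_one] using this
  · rw [twist_apply_of_lt (not_le.mp hi)]
    exact J.zero_mem

theorem infMul_mem_ideal (hJ : IsAdicTopology J) (A : Matrix ℕ ℕ R) {B : Matrix ℕ (Fin s) R}
    (hB : ∀ i j, B i j ∈ J) (i : ℕ) (j : Fin s) : infMul A B i j ∈ J := by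
  have := infMul_mem (k := 1) hJ A (B := B) (j := j) (by simpa [Submodule.pow_one] using (hB · j)) i
  simpa [Submodule.pow_one] using this

theorem riccatiMap_mem_rowsIn (hJ : IsAdicTopology J) (hT : T ∈ J)
    (hb : ∀ (i : ℕ) (j : Fin s), b ≤ i → s ≤ i → lam j < lam i)
    (hM' : ∀ (i : ℕ) (j : Fin s), s ≤ i → i < b → M' i j ∈ J) {Z : Matrix ℕ (Fin s) R}
    (hZ : Z ∈ rowsIn J s b) : riccatiMap T lam M' K Z ∈ rowsIn J s b := by
  intro i j hi hib
  refine mul_apply_mem_right (fun k => ?_) K j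
  have hY := infMul_mem_ideal hJ M' (twist_mem_of_rowsIn hT hb hZ)
  exact J.sub_mem (J.add_mem (hM' i k hi hib) (hY i k))
    (mul_apply_mem_right (fun l => hZ i l hi hib) _ k)

/-- The gain in the difference is the gain in its twist, up to one power of `J`. The part of the
quadratic term that contains `Z - W` untwisted always gains one power, because `twist T lam Z` has
entries in `J`. -/
theorem riccatiMap_sub_mem (hJ : IsAdicTopology J) (hT : T ∈ J) (hlam : Tendsto lam atTop atTop)
    (hb : ∀ (i : ℕ) (j : Fin s), b ≤ i → s ≤ i → lam j < lam i)
    {Z W : Matrix ℕ (Fin s) R} (hZ : Z ∈ rowsIn J s b) {m m' : ℕ} (hm' : m' ≤ m + 1)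
    (h : Z - W ∈ entriesIn ℕ (Fin s) (J ^ m))
    (htw : twist T lam (Z - W) ∈ entriesIn ℕ (Fin s) (J ^ m')) :
    riccatiMap T lam M' K Z - riccatiMap T lam M' K W ∈ entriesIn ℕ (Fin s) (J ^ m') := by
  rw [riccatiMap_sub hJ hT hlam]
  refine mul_mem_entriesIn_right (fun i j => ?_) K
  have hY := infMul_mem_ideal hJ M' (twist_mem_of_rowsIn hT hb hZ)
  refine Ideal.sub_mem _ (Ideal.sub_mem _ (infMul_mem hJ M' (fun k => htw k j) i) ?_) ?_
  · refine Ideal.pow_le_pow_right hm' (mul_apply_mem_pow_add (fun k => h i k) fun k => ?_)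
    simpa [Submodule.pow_one] using hY k j
  · exact mul_row_mem_left W (B := (infMul M' (twist T lam (Z - W))).submatrix (Fin.val : Fin s → ℕ) id)
      (fun k l => infMul_mem hJ M' (fun r => htw r l) k) i j

/-- Isolates the part of the linear term that is not contracting: the twist contributes a positive
power of `T` except in rows `[s, b)` and columns `[a, s)`, where its exponent is zero. -/
theorem infMul_twist_sub_mem (hJ : IsAdicTopology J) (hT : T ∈ J)
    (hlam : Tendsto lam atTop atTop)
    (hb : ∀ (i : ℕ) (j : Fin s), s ≤ i → b ≤ i ∨ (j : ℕ) < a → lam j < lam i)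
    (heq : ∀ (i : ℕ) (j : Fin s), s ≤ i → i < b → a ≤ j → lam i = lam j)
    {D : Matrix ℕ (Fin s) R} {m : ℕ} (hD : D ∈ entriesIn ℕ (Fin s) (J ^ m))
    (i : Fin b) (hi : s ≤ i) (j : Fin s) :
    infMul M' (twist T lam D) i j -
      (cornerBlock M' s b * D.submatrix (Fin.val : Fin b → ℕ) id * tailProj R a s) i j ∈ J ^ (m + 1) := by
  -- `E` is the untwisted part of `D`; `twist T lam D - E` lies in `J ^ (m + 1)`.
  let E : Matrix ℕ (Fin s) R := fun k l => if s ≤ k ∧ k < b ∧ a ≤ l then D k l else 0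
  have hE : ColNull E := fun l => tendsto_const_nhds.congr' <|
    (eventually_ge_atTop b).mono fun k hk => by simp [E, not_lt.mpr hk]
  have hEM : infMul M' E i j =
      (cornerBlock M' s b * D.submatrix (Fin.val : Fin b → ℕ) id * tailProj R a s) i j := by
    rw [tailProj, Matrix.mul_diagonal, infMul, tsum_eq_sum (s := Finset.range b), Matrix.mul_apply,
      Finset.sum_mul, ← Fin.sum_univ_eq_sum_range (fun k => M' i k * E k j)]
    · refine Finset.sum_congr rfl fun k _ => ?_
      by_cases hk : s ≤ (k : ℕ) <;> by_cases hj : a ≤ (j : ℕ) <;> simp [E, cornerBlock, hk, hj, hi]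
    · intro k hk
      simp [E, Finset.mem_range.not.mp hk]
  rw [← hEM, ← Matrix.sub_apply, ← infMul_sub hJ M' (colNull_twist hJ hT hlam D) hE]
  refine infMul_mem hJ M' (fun k => ?_) i
  rw [Matrix.sub_apply]
  by_cases h : s ≤ k ∧ k < b ∧ a ≤ j
  · simp [E, h, twist, heq k j h.1 h.2.1 h.2.2]
  · simp only [E, if_neg h, sub_zero]
    refine twist_mem_succ hT (fun hk => hb k j hk ?_) (hD k j)
    by_contra hcon
    push Not at hcon
    exact h ⟨hk, hcon⟩

/-- Leading linear part of the Riccati map on rows in `[s, b)`. Both quadratic contributions gain a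
power of `J`: one through the twist of `Z`, the other because these rows of `W` lie in `J`. -/
theorem riccatiMap_sub_sub_mem (hJ : IsAdicTopology J) (hT : T ∈ J)
    (hlam : Tendsto lam atTop atTop)
    (hb : ∀ (i : ℕ) (j : Fin s), s ≤ i → b ≤ i ∨ (j : ℕ) < a → lam j < lam i)
    (heq : ∀ (i : ℕ) (j : Fin s), s ≤ i → i < b → a ≤ j → lam i = lam j)
    {Z W : Matrix ℕ (Fin s) R} (hZ : Z ∈ rowsIn J s b) (hW : W ∈ rowsIn J s b) {m : ℕ}
    (h : Z - W ∈ entriesIn ℕ (Fin s) (J ^ m)) (i : Fin b) (hi : s ≤ i) (j : Fin s) :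
    (riccatiMap T lam M' K Z - riccatiMap T lam M' K W) i j -
      (cornerBlock M' s b * (Z - W).submatrix (Fin.val : Fin b → ℕ) id * (tailProj R a s * K)) i j ∈
        J ^ (m + 1) := by
  rw [riccatiMap_sub hJ hT hlam, ← Matrix.mul_assoc]
  have hY := infMul_mem_ideal hJ M' (twist_mem_of_rowsIn hT (fun i j h1 h2 => hb i j h2 (.inl h1)) hZ)
  have htw : ∀ k l, infMul M' (twist T lam (Z - W)) k l ∈ J ^ m := fun k l =>
    infMul_mem hJ M' (fun r => twist_mem (h r l)) k
  have hrow : ∀ l, (infMul M' (twist T lam (Z - W)) -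
        (Z - W) * (infMul M' (twist T lam Z)).submatrix (Fin.val : Fin s → ℕ) id -
        W * (infMul M' (twist T lam (Z - W))).submatrix (Fin.val : Fin s → ℕ) id) i l -
      (cornerBlock M' s b * (Z - W).submatrix (Fin.val : Fin b → ℕ) id * tailProj R a s) i l ∈ J ^ (m + 1) := by
    intro l
    have h1 := infMul_twist_sub_mem (M' := M') hJ hT hlam hb heq h i hi l
    have h2 : ((Z - W) * (infMul M' (twist T lam Z)).submatrix (Fin.val : Fin s → ℕ) id) i l ∈ J ^ (m + 1) :=
      mul_apply_mem_pow_add (fun k => h i k) fun k => by simpa [Submodule.pow_one] using hY k l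
    have h3 : (W * (infMul M' (twist T lam (Z - W))).submatrix (Fin.val : Fin s → ℕ) id) i l ∈ J ^ (m + 1) := by
      rw [add_comm]
      exact mul_apply_mem_pow_add
        (fun k => by simpa [Submodule.pow_one] using hW i k hi i.2) fun k => htw k l
    have := Ideal.sub_mem _ (Ideal.sub_mem _ h1 h2) h3
    simp only [Matrix.sub_apply] at this ⊢
    convert this using 1
    abel
  rw [Matrix.mul_apply, Matrix.mul_apply, ← Finset.sum_sub_distrib]
  refine Ideal.sum_mem _ fun l _ => ?_
  rw [← sub_mul]
  exact (J ^ (m + 1)).mul_mem_right _ (hrow l)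

theorem iterate_riccatiMap_sub_mem (hJ : IsAdicTopology J) (hT : T ∈ J)
    (hlam : Tendsto lam atTop atTop)
    (hb : ∀ (i : ℕ) (j : Fin s), s ≤ i → b ≤ i ∨ (j : ℕ) < a → lam j < lam i)
    (heq : ∀ (i : ℕ) (j : Fin s), s ≤ i → i < b → a ≤ j → lam i = lam j)
    (hM' : ∀ (i : ℕ) (j : Fin s), s ≤ i → i < b → M' i j ∈ J)
    {Z W : Matrix ℕ (Fin s) R} (hZ : Z ∈ rowsIn J s b) (hW : W ∈ rowsIn J s b) {m : ℕ}
    (h : Z - W ∈ entriesIn ℕ (Fin s) (J ^ m)) (t : ℕ) :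
    (riccatiMap T lam M' K)^[t] Z ∈ rowsIn J s b ∧ (riccatiMap T lam M' K)^[t] W ∈ rowsIn J s b ∧
    (riccatiMap T lam M' K)^[t] Z - (riccatiMap T lam M' K)^[t] W ∈
      entriesIn ℕ (Fin s) (J ^ m) ∧
    ∀ (i : Fin b) (j : Fin s), s ≤ i →
      ((riccatiMap T lam M' K)^[t] Z - (riccatiMap T lam M' K)^[t] W) i j -
        (cornerBlock M' s b ^ t * (Z - W).submatrix (Fin.val : Fin b → ℕ) id *
          (tailProj R a s * K) ^ t) i j ∈ J ^ (m + 1) := by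
  have hb' : ∀ (i : ℕ) (j : Fin s), b ≤ i → s ≤ i → lam j < lam i :=
    fun i j h1 h2 => hb i j h2 (.inl h1)
  induction t with
  | zero => simp [hZ, hW, h]
  | succ t ih =>
    obtain ⟨h1, h2, h3, h4⟩ := ih
    simp only [Function.iterate_succ_apply']
    set Z' := (riccatiMap T lam M' K)^[t] Z
    set W' := (riccatiMap T lam M' K)^[t] W
    refine ⟨riccatiMap_mem_rowsIn hJ hT hb' hM' h1, riccatiMap_mem_rowsIn hJ hT hb' hM' h2,
      riccatiMap_sub_mem hJ hT hlam hb' h1 (Nat.le_succ m) h3 fun i j => twist_mem (h3 i j),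
      fun i j hi => ?_⟩
    have h5 := riccatiMap_sub_sub_mem (M' := M') (K := K) hJ hT hlam hb heq h1 h2 h3 i hi j
    have h6 : (cornerBlock M' s b * ((Z' - W').submatrix (Fin.val : Fin b → ℕ) id -
        cornerBlock M' s b ^ t * (Z - W).submatrix (Fin.val : Fin b → ℕ) id *
          (tailProj R a s * K) ^ t) * (tailProj R a s * K)) i j ∈ J ^ (m + 1) := by
      refine mul_apply_mem_right (fun l => ?_) _ j
      rw [Matrix.mul_apply]
      refine Ideal.sum_mem _ fun k _ => ?_
      by_cases hk : s ≤ (k : ℕ)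
      · exact Ideal.mul_mem_left _ _ (h4 k l hk)
      · simp [cornerBlock, hk]
    have := Ideal.add_mem _ h5 h6
    have hpow : cornerBlock M' s b * (cornerBlock M' s b ^ t *
        (Z - W).submatrix (Fin.val : Fin b → ℕ) id * (tailProj R a s * K) ^ t) *
          (tailProj R a s * K) = cornerBlock M' s b ^ (t + 1) *
            (Z - W).submatrix (Fin.val : Fin b → ℕ) id * (tailProj R a s * K) ^ (t + 1) := by
      rw [pow_succ' (cornerBlock M' s b), pow_succ (tailProj R a s * K)]
      simp only [Matrix.mul_assoc]
    rw [Matrix.mul_sub, Matrix.sub_mul, hpow, Matrix.sub_apply (_ * _)] at this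
    rwa [sub_add_sub_cancel] at this

/-- After `k` iterations the nilpotent leading part has vanished modulo `J`, so the rows in `[s, b)`
of a difference have gained a power of `J`. One further application passes the gain to all rows,
since the twist kills the rows below `s` and supplies a factor `T` in the rows from `b` on. -/
theorem exists_riccatiMap_fixedPoint (hJ : IsAdicTopology J) (hc : IsCompleteAdic J) (hT : T ∈ J)
    (hlam : Tendsto lam atTop atTop)
    (hb : ∀ (i : ℕ) (j : Fin s), s ≤ i → b ≤ i ∨ (j : ℕ) < a → lam j < lam i)
    (heq : ∀ (i : ℕ) (j : Fin s), s ≤ i → i < b → a ≤ j → lam i = lam j)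
    (hM' : ∀ (i : ℕ) (j : Fin s), s ≤ i → i < b → M' i j ∈ J) {k : ℕ}
    (hnil : cornerBlock M' s b ^ k ∈ entriesIn (Fin b) (Fin b) J ∨
      (tailProj R a s * K) ^ k ∈ entriesIn (Fin s) (Fin s) J) :
    ∃ Z, riccatiMap T lam M' K Z = Z := by
  have hb' : ∀ (i : ℕ) (j : Fin s), b ≤ i → s ≤ i → lam j < lam i :=
    fun i j h1 h2 => hb i j h2 (.inl h1)
  obtain ⟨Z, -, hZ⟩ := exists_fixedPoint (fun k => entriesIn ℕ (Fin s) (J ^ k))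
    entriesIn_pow_antitone entriesIn_pow_zero (eq_zero_of_forall_mem_entriesIn hc)
    (exists_entriesIn_limit hc) (rowsIn J s b)
    (fun A hA i j _ _ => by simpa [Submodule.pow_one] using hA i j) (riccatiMap T lam M' K)
    (fun Z hZ => riccatiMap_mem_rowsIn hJ hT hb' hM' hZ) (k + 1) (fun m Z hZ W hW h => by
      obtain ⟨h1, -, h3, h4⟩ := iterate_riccatiMap_sub_mem (K := K) hJ hT hlam hb heq hM' hZ hW h k
      simp only [Function.iterate_succ_apply']
      refine riccatiMap_sub_mem hJ hT hlam hb' h1 le_rfl h3 fun i j => ?_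
      by_cases hi : s ≤ i ∧ i < b
      · refine twist_mem ?_
        have h5 : (cornerBlock M' s b ^ k * (Z - W).submatrix (Fin.val : Fin b → ℕ) id *
            (tailProj R a s * K) ^ k) ⟨i, hi.2⟩ j ∈ J ^ (m + 1) := by
          rcases hnil with hnil | hnil
          · refine mul_apply_mem_right (fun l => ?_) _ j
            rw [add_comm]
            exact mul_apply_mem_pow_add (by simpa [Submodule.pow_one] using hnil _) fun r => h r l
          · rw [Matrix.mul_assoc]
            refine mul_row_mem_left _ (fun r l => ?_) _ _
            exact mul_apply_mem_pow_add (fun q => h r q)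
              (by simpa [Submodule.pow_one] using (hnil · l))
        simpa using Ideal.add_mem _ (h4 ⟨i, hi.2⟩ j hi.1) h5
      · refine twist_mem_succ hT (fun his => hb i j his (.inl ?_)) (h3 i j)
        by_contra hcon
        exact hi ⟨his, not_le.mp hcon⟩)
  exact ⟨Z, hZ⟩

end Riccati

/-! ### From a Riccati fixed point to a block triangularization -/

section BlockTriangular

variable {R : Type*} [Ring R] [UniformSpace R] [IsUniformAddGroup R] [NonarchimedeanRing R]
  [CompleteSpace R] [T2Space R] {J : Ideal R} [J.IsTwoSided] {T : R} {lam : ℕ → ℕ} {s : ℕ}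

theorem IsHodgeBounded.colNull (hJ : IsAdicTopology J) (hT : T ∈ J)
    (hlam : Tendsto lam atTop atTop) {M : Matrix ℕ ℕ R} (hM : IsHodgeBounded T lam M) :
    ColNull M := by
  obtain ⟨M', hM'⟩ := hM
  intro j
  rw [hJ.tendsto_zero_iff]
  intro n
  filter_upwards [hlam.eventually_ge_atTop n] with i hi
  rw [hM']
  exact (J ^ n).mul_mem_right _ (Ideal.pow_le_pow_right hi (pow_mem_pow hT _))

theorem infMul_pow_mul (hJ : IsAdicTopology J) {A A' : Matrix ℕ ℕ R}
    (hA : ∀ i j, A i j = T ^ lam i * A' i j) {B : Matrix ℕ ℕ R} (hB : ColNull B) (i j : ℕ) :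
    infMul A B i j = T ^ lam i * infMul A' B i j := by
  simp only [infMul, hA, mul_assoc]
  exact (summable_infMul hJ A' hB i j).tsum_mul_left _

theorem mul_infMul (hJ : IsAdicTopology J) {m n : Type*} (A : Matrix m (Fin s) R)
    (B : Matrix (Fin s) ℕ R) {C : Matrix ℕ n R} (hC : ColNull C) :
    infMul (A * B) C = A * infMul B C := by
  ext i j
  simp only [infMul, Matrix.mul_apply, Finset.sum_mul]
  rw [Summable.tsum_finsetSum]
  · refine Finset.sum_congr rfl fun k _ => ?_
    simp only [mul_assoc]
    exact (summable_infMul hJ B hC k j).tsum_mul_left _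
  · intro k _
    simp only [mul_assoc]
    exact (summable_infMul hJ B hC k j).mul_left _

/-- Extension of a matrix with `s` columns by zero columns. -/
def extendCols {R : Type*} [Zero R] (Z : Matrix ℕ (Fin s) R) : Matrix ℕ ℕ R :=
  fun i j => if h : j < s then Z i ⟨j, h⟩ else 0

theorem colNull_extendCols {Z : Matrix ℕ (Fin s) R} (hZ : ColNull Z) : ColNull (extendCols Z) := by
  intro j
  by_cases hj : j < s
  · simpa [extendCols, hj] using hZ ⟨j, hj⟩
  · simp [extendCols, hj]

theorem infMul_extendCols_left (Z : Matrix ℕ (Fin s) R) {n : Type*} (B : Matrix ℕ n R) :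
    infMul (extendCols Z) B = Z * B.submatrix (Fin.val : Fin s → ℕ) id := by
  ext i j
  rw [infMul, tsum_eq_sum (s := Finset.range s), Matrix.mul_apply,
    ← Fin.sum_univ_eq_sum_range (fun k => extendCols Z i k * B k j)]
  · simp [extendCols]
  · intro k hk
    simp [extendCols, Finset.mem_range.not.mp hk]

theorem infMul_extendCols_right (A : Matrix ℕ ℕ R) (Z : Matrix ℕ (Fin s) R) :
    infMul A (extendCols Z) = extendCols (infMul A Z) := by
  ext i j
  by_cases hj : j < s <;> simp [infMul, extendCols, hj]

/-- The rows from `s` on. -/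
def tailRows {R : Type*} [Zero R] {n : Type*} (s : ℕ) (Z : Matrix ℕ n R) : Matrix ℕ n R :=
  fun i j => if s ≤ i then Z i j else 0

/-- The powers combine as `T ^ (lam i - lam j) * T ^ lam j = T ^ lam i`, because `T` is central and
`lam j ≤ lam i` for `j < s ≤ i`. This is what makes the conjugating matrix stable. -/
theorem twist_mul_pow_mul (hTc : ∀ x : R, T * x = x * T) (hmono : Monotone lam)
    (Z : Matrix ℕ (Fin s) R) {B B' : Matrix ℕ ℕ R} (hB : ∀ i j, B i j = T ^ lam i * B' i j)
    (i j : ℕ) : (twist T lam Z * B.submatrix (Fin.val : Fin s → ℕ) id) i j =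
      T ^ lam i * (tailRows s Z * B'.submatrix (Fin.val : Fin s → ℕ) id) i j := by
  rw [Matrix.mul_apply, Matrix.mul_apply, Finset.mul_sum]
  refine Finset.sum_congr rfl fun k _ => ?_
  by_cases hi : s ≤ i
  · have hTk : ∀ x : R, x * T ^ lam k = T ^ lam k * x := fun x =>
      (((show Commute T x from hTc x).pow_left _).eq).symm
    simp only [twist, tailRows, if_pos hi, Matrix.submatrix_apply, id, hB]
    rw [← mul_assoc, mul_assoc _ (Z i k), hTk, ← mul_assoc, ← pow_add,
      Nat.sub_add_cancel (hmono (by omega)), mul_assoc]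
  · simp [twist, tailRows, hi]

theorem twist_top (Z : Matrix ℕ (Fin s) R) :
    (twist T lam Z).submatrix (Fin.val : Fin s → ℕ) id = 0 := by
  ext i j
  simp [twist]

/-- A fixed point of the Riccati map gives a block triangularization. -/
theorem exists_blockTriangular_of_fixedPoint (hJ : IsAdicTopology J) (hT : T ∈ J)
    (hTc : ∀ x : R, T * x = x * T) (hmono : Monotone lam) (hlam : Tendsto lam atTop atTop)
    {M M' : Matrix ℕ ℕ R} (hM : ∀ i j, M i j = T ^ lam i * M' i j)
    {K : Matrix (Fin s) (Fin s) R} (hK : K * M'.submatrix (Fin.val : Fin s → ℕ) (Fin.val : Fin s → ℕ) = 1)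
    {Z : Matrix ℕ (Fin s) R} (hZ : riccatiMap T lam M' K Z = Z) :
    ∃ Q Q' : Matrix ℕ ℕ R, ColNull Q ∧ ColNull Q' ∧ infMul Q Q' = 1 ∧ infMul Q' Q = 1 ∧
      (∀ B, IsHodgeBounded T lam B → IsHodgeBounded T lam (infMul Q B)) ∧
      ∀ i j, s ≤ i → j < s → infMul (infMul Q M) Q' i j = 0 := by
  set X := extendCols (twist T lam Z)
  have htw := colNull_twist hJ hT hlam Z
  have hX : ColNull X := colNull_extendCols htw
  -- `X` has columns only below `s` and rows only from `s` on, so `1 - X` and `1 + X` are mutually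
  -- inverse.
  have hXX : infMul X X = 0 := by
    rw [infMul_extendCols_right, infMul_extendCols_left, twist_top, Matrix.mul_zero]
    ext i j
    simp [extendCols]
  have hQ : ColNull (1 - X) := ColNull.one.sub hX
  have hQ' : ColNull (1 + X) := ColNull.one.add hX
  have hXB : ∀ B B' : Matrix ℕ ℕ R, (∀ i j, B i j = T ^ lam i * B' i j) → ColNull B →
      ∀ i j, infMul (1 - X) B i j =
      T ^ lam i * (B' - tailRows s Z * B'.submatrix (Fin.val : Fin s → ℕ) id) i j := by
    intro B B' hB hBn i j
    rw [sub_infMul hJ _ _ hBn, one_infMul, infMul_extendCols_left, Matrix.sub_apply,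
      twist_mul_pow_mul hTc hmono Z hB, hB, ← mul_sub, Matrix.sub_apply]
  refine ⟨1 - X, 1 + X, hQ, hQ', ?_, ?_, ?_, ?_⟩
  · rw [sub_infMul hJ _ _ hQ', one_infMul, infMul_add hJ _ ColNull.one hX, infMul_one, hXX]
    abel
  · rw [add_infMul hJ _ _ hQ, one_infMul, infMul_sub hJ _ ColNull.one hX, infMul_one, hXX]
    abel
  · rintro B hB
    have hBn := hB.colNull hJ hT hlam
    obtain ⟨B', hB'⟩ := hB
    exact ⟨_, hXB B B' hB' hBn⟩
  · intro i j hi hj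
    have hMn : ColNull M := IsHodgeBounded.colNull hJ hT hlam ⟨M', hM⟩
    rw [infMul_pow_mul hJ (hXB M M' hM hMn) hQ', infMul_add hJ _ ColNull.one hX, infMul_one,
      infMul_extendCols_right, sub_infMul hJ _ _ htw, mul_infMul hJ _ _ htw]
    -- Multiplying the fixed point equation on the right by the head block removes `K`.
    have hfix : M'.submatrix id (Fin.val : Fin s → ℕ) + infMul M' (twist T lam Z) -
        Z * (infMul M' (twist T lam Z)).submatrix (Fin.val : Fin s → ℕ) id =
        Z * M'.submatrix (Fin.val : Fin s → ℕ) (Fin.val : Fin s → ℕ) := by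
      nth_rewrite 4 [← hZ]
      rw [riccatiMap, Matrix.mul_assoc, hK, Matrix.mul_one]
    have hij := congrFun (congrFun hfix i) ⟨j, hj⟩
    have htail : ∀ (n : Type) (C : Matrix (Fin s) n R) (k : n),
        (tailRows s Z * C) i k = (Z * C) i k := by
      intro n C k
      simp [Matrix.mul_apply, tailRows, hi]
    rw [Matrix.add_apply, Matrix.sub_apply, htail, extendCols, dif_pos hj, Matrix.sub_apply, htail]
    rw [Matrix.sub_apply, Matrix.add_apply] at hij
    have hcol : (Z * M'.submatrix (Fin.val : Fin s → ℕ) id) i j =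
        (Z * M'.submatrix (Fin.val : Fin s → ℕ) (Fin.val : Fin s → ℕ)) i ⟨j, hj⟩ := rfl
    have hY : infMul (M'.submatrix (Fin.val : Fin s → ℕ) id) (twist T lam Z) =
        (infMul M' (twist T lam Z)).submatrix (Fin.val : Fin s → ℕ) id := rfl
    rw [hcol, ← hij, hY]
    refine (congrArg (T ^ lam i * ·) ?_).trans (mul_zero _)
    simp only [Matrix.submatrix_apply, id]
    abel

end BlockTriangular

/-! ### Finite base changes as infinite matrices -/

section FiniteConjugation

variable {R : Type*} [Ring R] {b : ℕ}

/-- Extension of a finite square matrix by the identity. -/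
def extendOne (C : Matrix (Fin b) (Fin b) R) : Matrix ℕ ℕ R :=
  fun i j => if h : i < b ∧ j < b then C ⟨i, h.1⟩ ⟨j, h.2⟩ else if i = j then 1 else 0

theorem extendOne_fin (C : Matrix (Fin b) (Fin b) R) (i j : Fin b) :
    extendOne C i j = C i j := by
  simp [extendOne]

theorem extendOne_apply_of_le_left (C : Matrix (Fin b) (Fin b) R) {i : ℕ} (hi : b ≤ i) (j : ℕ) :
    extendOne C i j = if i = j then 1 else 0 := by
  simp [extendOne, not_lt.mpr hi]

theorem extendOne_apply_of_le_right (C : Matrix (Fin b) (Fin b) R) (i : ℕ) {j : ℕ} (hj : b ≤ j) :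
    extendOne C i j = if i = j then 1 else 0 := by
  simp [extendOne, not_lt.mpr hj]

variable [TopologicalSpace R]

theorem extendOne_infMul_fin (C : Matrix (Fin b) (Fin b) R) {n : Type*} (B : Matrix ℕ n R)
    (i : Fin b) (j : n) : infMul (extendOne C) B i j = ∑ k : Fin b, C i k * B k j := by
  rw [infMul, tsum_eq_sum (s := Finset.range b),
    ← Fin.sum_univ_eq_sum_range (fun k => extendOne C i k * B k j)]
  · simp [extendOne_fin]
  · intro k hk
    have hk' : b ≤ k := by simpa using hk
    rw [extendOne_apply_of_le_right C _ hk', if_neg (by omega), zero_mul]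

theorem extendOne_infMul_of_le (C : Matrix (Fin b) (Fin b) R) {n : Type*} (B : Matrix ℕ n R)
    {i : ℕ} (hi : b ≤ i) (j : n) : infMul (extendOne C) B i j = B i j := by
  rw [infMul, tsum_eq_single i]
  · simp [extendOne_apply_of_le_left C hi]
  · intro k hk
    simp [extendOne_apply_of_le_left C hi, hk.symm]

theorem infMul_extendOne_fin {m : Type*} (A : Matrix m ℕ R) (C : Matrix (Fin b) (Fin b) R)
    (i : m) (j : Fin b) : infMul A (extendOne C) i j = ∑ k : Fin b, A i k * C k j := by
  rw [infMul, tsum_eq_sum (s := Finset.range b),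
    ← Fin.sum_univ_eq_sum_range (fun k => A i k * extendOne C k j)]
  · simp [extendOne_fin]
  · intro k hk
    have hk' : b ≤ k := by simpa using hk
    rw [extendOne_apply_of_le_left C hk', if_neg (by omega), mul_zero]

theorem extendOne_infMul_extendOne {C D : Matrix (Fin b) (Fin b) R} (h : C * D = 1) :
    infMul (extendOne C) (extendOne D) = 1 := by
  ext i j
  by_cases hi : i < b
  · rw [extendOne_infMul_fin C _ ⟨i, hi⟩]
    by_cases hj : j < b
    · have := congrFun (congrFun h ⟨i, hi⟩) ⟨j, hj⟩
      rw [Matrix.mul_apply] at this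
      simp only [← extendOne_fin D] at this
      simpa [Matrix.one_apply] using this
    · rw [Matrix.one_apply_ne (by omega)]
      refine Finset.sum_eq_zero fun k _ => ?_
      rw [extendOne_apply_of_le_right D _ (not_lt.mp hj), if_neg (by omega), mul_zero]
  · rw [extendOne_infMul_of_le C _ (not_lt.mp hi), extendOne_apply_of_le_left D (not_lt.mp hi),
      Matrix.one_apply]

theorem colNull_extendOne (C : Matrix (Fin b) (Fin b) R) : ColNull (extendOne C) := fun j =>
  tendsto_const_nhds.congr' <| (eventually_ge_atTop (max b (j + 1))).mono fun i hi => by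
    change 0 = extendOne C i j
    rw [extendOne_apply_of_le_left C (le_of_max_le_left hi), if_neg]
    have := le_of_max_le_right hi
    omega

/-- If `C Δ = Δ C'` with `Δ = Diag(T ^ lam)`, then `C` preserves Hodge bounds and acts on the
cofactor `B'` through `C'`. Hence conjugating `M` by `C` replaces `M'` by `C' M' C⁻¹`, where the two
outer factors may reduce differently modulo `J`. -/
theorem extendOne_infMul_pow_mul {T : R} {lam : ℕ → ℕ}
    {C C' : Matrix (Fin b) (Fin b) R} (hC : ∀ i j, C i j * T ^ lam j = T ^ lam i * C' i j)
    {B B' : Matrix ℕ ℕ R} (hB : ∀ i j, B i j = T ^ lam i * B' i j) (i j : ℕ) :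
    infMul (extendOne C) B i j = T ^ lam i * infMul (extendOne C') B' i j := by
  by_cases hi : i < b
  · rw [extendOne_infMul_fin C _ ⟨i, hi⟩, extendOne_infMul_fin C' _ ⟨i, hi⟩, Finset.mul_sum]
    refine Finset.sum_congr rfl fun k _ => ?_
    rw [hB, ← mul_assoc, hC, mul_assoc]
  · rw [extendOne_infMul_of_le C _ (not_lt.mp hi), extendOne_infMul_of_le C' _ (not_lt.mp hi), hB]

theorem extendOne_conj_fin (C D : Matrix (Fin b) (Fin b) R) (B : Matrix ℕ ℕ R) :
    (infMul (infMul (extendOne C) B) (extendOne D)).submatrix (Fin.val : Fin b → ℕ)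
      (Fin.val : Fin b → ℕ) =
      C * B.submatrix (Fin.val : Fin b → ℕ) (Fin.val : Fin b → ℕ) * D := by
  ext i j
  rw [Matrix.submatrix_apply, infMul_extendOne_fin, Matrix.mul_apply]
  refine Finset.sum_congr rfl fun k _ => ?_
  rw [extendOne_infMul_fin, Matrix.mul_apply]
  rfl

end FiniteConjugation

/-! ### Assembly of the base change and the Riccati conjugation -/

section Triangularization

variable {R : Type*} [Ring R] [UniformSpace R] [IsUniformAddGroup R] [NonarchimedeanRing R]
  [CompleteSpace R] [T2Space R] {J : Ideal R} [J.IsTwoSided] {T : R} {lam : ℕ → ℕ} {s a b : ℕ}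

/-- A Hodge bounded matrix is block triangularizable if, after a base change in the first `b`
coordinates, its reduction is block triangular with an invertible first block and a nilpotent
contribution of the coordinates in `[a, b)` to the Riccati map. -/
theorem exists_blockTriangular (hJ : IsAdicTopology J) (hc : IsCompleteAdic J) (hT : T ∈ J)
    (hTc : ∀ x : R, T * x = x * T) (hmono : Monotone lam) (hlam : Tendsto lam atTop atTop)
    (hsb : s ≤ b)
    (hb : ∀ (i : ℕ) (j : Fin s), s ≤ i → b ≤ i ∨ (j : ℕ) < a → lam j < lam i)
    (heq : ∀ (i : ℕ) (j : Fin s), s ≤ i → i < b → a ≤ j → lam i = lam j)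
    {M M' : Matrix ℕ ℕ R} (hM : ∀ i j, M i j = T ^ lam i * M' i j)
    {C C' D N : Matrix (Fin b) (Fin b) R} (hCD : C * D = 1) (hDC : D * C = 1)
    (hC : ∀ i j, C i j * T ^ lam j = T ^ lam i * C' i j)
    (hN : N = C' * M'.submatrix (Fin.val : Fin b → ℕ) (Fin.val : Fin b → ℕ) * D)
    (hNJ : ∀ i j : Fin b, s ≤ i → (j : ℕ) < s → N i j ∈ J)
    {K : Matrix (Fin s) (Fin s) R}
    (hK : K * N.submatrix (Fin.castLE hsb) (Fin.castLE hsb) = 1) {k : ℕ}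
    (hnil : (Matrix.of fun i j : Fin b => if s ≤ i ∧ s ≤ j then N i j else 0) ^ k ∈
        entriesIn (Fin b) (Fin b) J ∨
      (tailProj R a s * K) ^ k ∈ entriesIn (Fin s) (Fin s) J) :
    ∃ Q Q' : Matrix ℕ ℕ R, IsInversePair J Q Q' ∧ IsStable J T lam Q ∧
      ∃ P N : Matrix ℕ ℕ R, IsMatProd J Q M P ∧ IsMatProd J P Q' N ∧
        IsHodgeBounded T lam N ∧ ∀ i j, s ≤ i → j < s → N i j = 0 := by
  set M₁' := infMul (infMul (extendOne C') M') (extendOne D) with hM₁'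
  set M₁ := infMul (infMul (extendOne C) M) (extendOne D) with hM₁
  have hC0 := colNull_extendOne C
  have hD0 := colNull_extendOne D
  have hM0 : ColNull M := IsHodgeBounded.colNull hJ hT hlam ⟨M', hM⟩
  have hM₁T : ∀ i j, M₁ i j = T ^ lam i * M₁' i j := fun i j =>
    infMul_pow_mul hJ (extendOne_infMul_pow_mul hC hM) hD0 i j
  have hM₁N : M₁'.submatrix (Fin.val : Fin b → ℕ) (Fin.val : Fin b → ℕ) = N := by
    rw [hN, hM₁', extendOne_conj_fin]
  have hM₁N' : ∀ i j : Fin b, M₁' i j = N i j := fun i j => by rw [← hM₁N]; rfl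
  have hM₁J : ∀ (i : ℕ) (j : Fin s), s ≤ i → i < b → M₁' i j ∈ J := fun i j hi hib => by
    have := hNJ ⟨i, hib⟩ (Fin.castLE hsb j) hi j.2
    rwa [← hM₁N'] at this
  have hcorner : cornerBlock M₁' s b =
      Matrix.of fun i j : Fin b => if s ≤ i ∧ s ≤ j then N i j else 0 := by
    ext i j
    simp [cornerBlock, hM₁N']
  rw [← hcorner] at hnil
  obtain ⟨Z, hZ⟩ := exists_riccatiMap_fixedPoint hJ hc hT hlam hb heq hM₁J hnil
  have hK' : K * M₁'.submatrix (Fin.val : Fin s → ℕ) (Fin.val : Fin s → ℕ) = 1 := by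
    rw [← hK, ← hM₁N]
    rfl
  obtain ⟨Q, Q', hQ, hQ', hQQ', hQ'Q, hstab, hzero⟩ :=
    exists_blockTriangular_of_fixedPoint hJ hT hTc hmono hlam hM₁T hK' hZ
  have hCM0 : ColNull (infMul (extendOne C) M) := colNull_infMul hJ hC0 hM0
  have hprod : infMul (infMul (infMul Q (extendOne C)) M) (infMul (extendOne D) Q') =
      infMul (infMul Q M₁) Q' := by
    rw [infMul_assoc hJ Q hC0 hM0, ← infMul_assoc hJ _ hD0 hQ', infMul_assoc hJ Q hCM0 hD0]
  have hstab' : ∀ B, IsHodgeBounded T lam B →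
      IsHodgeBounded T lam (infMul (infMul Q (extendOne C)) B) := by
    intro B hB
    rw [infMul_assoc hJ Q hC0 (hB.colNull hJ hT hlam)]
    obtain ⟨B', hB'⟩ := hB
    exact hstab _ ⟨_, extendOne_infMul_pow_mul hC hB'⟩
  have hQC := colNull_infMul hJ hQ hC0
  have hDQ := colNull_infMul hJ hD0 hQ'
  have hnull : ∀ {A : Matrix ℕ ℕ R}, ColNull A → IsColumnNull J A := fun hA j =>
    hJ.adicTendsto_iff.mpr (hA j)
  refine ⟨infMul Q (extendOne C), infMul (extendOne D) Q', ⟨hnull hQC, hnull hDQ, ?_, ?_⟩, ?_,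
    infMul (infMul Q (extendOne C)) M,
    infMul (infMul (infMul Q (extendOne C)) M) (infMul (extendOne D) Q'),
    isMatProd_infMul hJ _ hM0, isMatProd_infMul hJ _ hDQ, ?_, ?_⟩
  · have := isMatProd_infMul hJ (infMul Q (extendOne C)) hDQ
    rwa [← infMul_assoc hJ _ hD0 hQ', infMul_assoc hJ Q hC0 hD0, extendOne_infMul_extendOne hCD,
      infMul_one, hQQ'] at this
  · have := isMatProd_infMul hJ (infMul (extendOne D) Q') hQC
    rwa [← infMul_assoc hJ _ hQ hC0, infMul_assoc hJ _ hQ' hQ, hQ'Q, infMul_one,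
      extendOne_infMul_extendOne hDC] at this
  · exact fun B hB => ⟨_, isMatProd_infMul hJ _ (hB.colNull hJ hT hlam), hstab' B hB⟩
  · obtain ⟨P', hP'⟩ := hstab' M ⟨M', hM⟩
    exact ⟨_, infMul_pow_mul hJ hP' hDQ⟩
  · rw [hprod]
    exact hzero

end Triangularization

/-! ### Coordinate subspaces over the residue field -/

section CoordinateSpaces

variable {F : Type*} [Field F]

theorem exists_linearEquiv_map_eq {E : Type*} [AddCommGroup E] [Module F E] [FiniteDimensional F E]
    {U U' : Submodule F E} (h : Module.finrank F U = Module.finrank F U') :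
    ∃ φ : E ≃ₗ[F] E, U.map (φ : E →ₗ[F] E) = U' := by
  obtain ⟨C, hC⟩ := U.exists_isCompl
  obtain ⟨C', hC'⟩ := U'.exists_isCompl
  have h1 := Submodule.finrank_add_eq_of_isCompl hC
  have h2 := Submodule.finrank_add_eq_of_isCompl hC'
  let e := LinearEquiv.ofFinrankEq U U' h
  let f : C ≃ₗ[F] C' := LinearEquiv.ofFinrankEq C C' (by omega)
  let φ := (Submodule.prodEquivOfIsCompl U C hC).symm ≪≫ₗ (e.prodCongr f) ≪≫ₗ
    Submodule.prodEquivOfIsCompl U' C' hC'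
  refine ⟨φ, Submodule.eq_of_le_of_finrank_eq ?_ ?_⟩
  · rintro _ ⟨u, hu, rfl⟩
    have : (Submodule.prodEquivOfIsCompl U C hC).symm u = (⟨u, hu⟩, 0) :=
      Submodule.prodEquivOfIsCompl_symm_apply_left U C hC ⟨u, hu⟩
    simp [φ, this]
  · rw [LinearEquiv.finrank_map_eq, h]

theorem exists_linearEquiv_map_eq_of_isCompl {E : Type*} [AddCommGroup E] [Module F E]
    [FiniteDimensional F E] {V₁ V₂ U U' : Submodule F E} (hV : IsCompl V₁ V₂) (hU : U ≤ V₂)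
    (hU' : U' ≤ V₂) (h : Module.finrank F U = Module.finrank F U') :
    ∃ φ : E ≃ₗ[F] E, (∀ v ∈ V₁, φ v = v) ∧ (∀ v ∈ V₂, φ v ∈ V₂) ∧
      U.map (φ : E →ₗ[F] E) = U' := by
  obtain ⟨e, he⟩ := exists_linearEquiv_map_eq (F := F) (E := V₂) (U := U.comap V₂.subtype)
    (U' := U'.comap V₂.subtype) (by
      rw [(Submodule.comapSubtypeEquivOfLe hU).finrank_eq,
        (Submodule.comapSubtypeEquivOfLe hU').finrank_eq, h])
  let φ := (Submodule.prodEquivOfIsCompl V₁ V₂ hV).symm ≪≫ₗ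
    ((LinearEquiv.refl F V₁).prodCongr e) ≪≫ₗ Submodule.prodEquivOfIsCompl V₁ V₂ hV
  have h1 : ∀ v (hv : v ∈ V₁), φ v = v := fun v hv => by
    have : (Submodule.prodEquivOfIsCompl V₁ V₂ hV).symm v = (⟨v, hv⟩, 0) :=
      Submodule.prodEquivOfIsCompl_symm_apply_left V₁ V₂ hV ⟨v, hv⟩
    simp [φ, this]
  have h2 : ∀ v (hv : v ∈ V₂), φ v = e ⟨v, hv⟩ := fun v hv => by
    have : (Submodule.prodEquivOfIsCompl V₁ V₂ hV).symm v = (0, ⟨v, hv⟩) :=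
      Submodule.prodEquivOfIsCompl_symm_apply_right V₁ V₂ hV ⟨v, hv⟩
    simp [φ, this]
  refine ⟨φ, h1, fun v hv => by rw [h2 v hv]; exact (e _).2,
    Submodule.eq_of_le_of_finrank_eq ?_ ?_⟩
  · rintro _ ⟨u, hu, rfl⟩
    have : e ⟨u, hU hu⟩ ∈ U'.comap V₂.subtype := by
      rw [← he]
      exact ⟨_, hu, rfl⟩
    rw [LinearEquiv.coe_coe, h2 u (hU hu)]
    exact this
  · rw [LinearEquiv.finrank_map_eq, h]

/-- The vectors supported on the coordinates in `[a, s)`. -/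
def midSpace (F : Type*) [Field F] (b a s : ℕ) : Submodule F (Fin b → F) where
  carrier := {v | ∀ i : Fin b, (i : ℕ) < a ∨ s ≤ i → v i = 0}
  add_mem' hv hw i hi := by simp [hv i hi, hw i hi]
  zero_mem' _ _ := rfl
  smul_mem' c v hv i hi := by simp [hv i hi]

variable {b : ℕ}

theorem mem_midSpace {a s : ℕ} {v : Fin b → F} :
    v ∈ midSpace F b a s ↔ ∀ i : Fin b, (i : ℕ) < a ∨ s ≤ i → v i = 0 := Iff.rfl

theorem finrank_midSpace {a s : ℕ} (hs : s ≤ b) :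
    Module.finrank F (midSpace F b a s) = s - a := by
  let I : Set (Fin b) := {i | a ≤ i ∧ (i : ℕ) < s}
  have h : midSpace F b a s = ⨅ i ∈ Iᶜ, LinearMap.ker (LinearMap.proj i : (Fin b → F) →ₗ[F] F) := by
    ext v
    simp only [mem_midSpace, Submodule.mem_iInf, LinearMap.mem_ker, LinearMap.proj_apply]
    refine forall_congr' fun i => ?_
    have : i ∈ Iᶜ ↔ (i : ℕ) < a ∨ s ≤ i := by
      simp only [I, Set.mem_compl_iff, Set.mem_ofPred_eq]
      omega
    rw [this]
  have : DecidablePred fun i => i ∈ I := Classical.decPred _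
  rw [h, (LinearMap.iInfKerProjEquiv F (fun _ : Fin b => F) (I := I) (J := Iᶜ)
    disjoint_compl_right (by simp)).finrank_eq, Module.finrank_fintype_fun_eq_card,
    ← Set.toFinset_card, ← Nat.card_Ico]
  refine Finset.card_bij (fun i _ => (i : ℕ)) (fun i hi => ?_) (fun i _ j _ h => Fin.ext h)
    fun k hk => ?_
  · simpa [I] using hi
  · rw [Finset.mem_Ico] at hk
    exact ⟨⟨k, by omega⟩, by simpa [I] using hk, rfl⟩

theorem isCompl_midSpace (a : ℕ) : IsCompl (midSpace F b 0 a) (midSpace F b a b) := by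
  constructor
  · rw [Submodule.disjoint_def]
    intro v h1 h2
    ext i
    by_cases hi : (i : ℕ) < a
    · exact h2 i (.inl hi)
    · exact h1 i (.inr (not_lt.mp hi))
  · rw [codisjoint_iff, eq_top_iff]
    intro v _
    rw [Submodule.mem_sup]
    refine ⟨fun i => if (i : ℕ) < a then v i else 0, fun i hi => ?_,
      fun i => if (i : ℕ) < a then 0 else v i, fun i hi => ?_, ?_⟩
    · exact if_neg (by omega)
    · exact if_pos (by omega)
    · ext i
      by_cases hi : (i : ℕ) < a <;> simp [hi]

/-- Every subspace of the tail coordinates is moved to a coordinate subspace by a base change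
which is the identity on the head coordinates. -/
theorem exists_baseChange {a : ℕ} (hab : a ≤ b) {U : Submodule F (Fin b → F)}
    (hU : U ≤ midSpace F b a b) :
    ∃ g h : Matrix (Fin b) (Fin b) F, g * h = 1 ∧ h * g = 1 ∧
      (∀ i j : Fin b, (i : ℕ) < a ∨ (j : ℕ) < a → g i j = (1 : Matrix (Fin b) (Fin b) F) i j) ∧
      ∃ s, a ≤ s ∧ s ≤ b ∧ U.map g.toLin' = midSpace F b a s := by
  have hd : Module.finrank F U ≤ b - a := by
    rw [← finrank_midSpace (F := F) (le_refl b)]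
    exact Submodule.finrank_mono hU
  have hs : a + Module.finrank F U ≤ b := by omega
  obtain ⟨φ, h1, h2, h3⟩ := exists_linearEquiv_map_eq_of_isCompl (isCompl_midSpace a) hU
    (U' := midSpace F b a (a + Module.finrank F U)) (fun v hv i hi => hv i (by omega))
    (by rw [finrank_midSpace hs]; omega)
  refine ⟨LinearMap.toMatrix' (φ : (Fin b → F) →ₗ[F] _), LinearMap.toMatrix' (φ.symm : (Fin b → F) →ₗ[F] _), ?_, ?_, ?_,
    _, Nat.le_add_right _ _, hs, by rw [Matrix.toLin'_toMatrix', h3]⟩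
  · rw [← LinearMap.toMatrix'_comp]; simp
  · rw [← LinearMap.toMatrix'_comp]; simp
  · intro i j hij
    rw [LinearMap.toMatrix'_apply]
    by_cases hj : (j : ℕ) < a
    · rw [LinearEquiv.coe_coe, h1 _ fun k hk => Pi.single_eq_of_ne (by rintro rfl; omega) _,
        Pi.single_apply, Matrix.one_apply]
    · rw [Matrix.one_apply_ne (by rintro rfl; omega)]
      refine h2 _ (fun k hk => ?_) i (.inl (by omega))
      exact Pi.single_eq_of_ne (by rintro rfl; omega) _

theorem eq_zero_of_eq_one_of_head {a : ℕ} {g : Matrix (Fin b) (Fin b) F}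
    (hg : ∀ i j : Fin b, (i : ℕ) < a ∨ (j : ℕ) < a → g i j = (1 : Matrix (Fin b) (Fin b) F) i j)
    (i j : Fin b) (hij : ¬((i : ℕ) < a ↔ (j : ℕ) < a)) : g i j = 0 := by
  rw [hg i j (by omega), Matrix.one_apply_ne (by rintro rfl; exact hij Iff.rfl)]

end CoordinateSpaces

/-! ### The linear relation and the pencil of a matrix -/

section Pencil

open Polynomial

variable {F : Type*} [Field F] {b : ℕ}

/-- The image of `U` under the linear relation on the coordinates `≥ a` defined by `A`. -/
def relStep (a : ℕ) (A : Matrix (Fin b) (Fin b) F) (U : Submodule F (Fin b → F)) :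
    Submodule F (Fin b → F) :=
  midSpace F b a b ⊓ (midSpace F b 0 a ⊔ U).map A.toLin'

theorem relStep_mono (a : ℕ) (A : Matrix (Fin b) (Fin b) F) : Monotone (relStep a A) :=
  fun _ _ h => inf_le_inf_left _ (Submodule.map_mono (sup_le_sup_left h _))

theorem relStep_le (a : ℕ) (A : Matrix (Fin b) (Fin b) F) (U : Submodule F (Fin b → F)) :
    relStep a A U ≤ midSpace F b a b := inf_le_left

theorem map_midSpace_head {a : ℕ} {g : Matrix (Fin b) (Fin b) F}
    (hg : ∀ i j : Fin b, ¬((i : ℕ) < a ↔ (j : ℕ) < a) → g i j = 0) :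
    (midSpace F b 0 a).map g.toLin' ≤ midSpace F b 0 a := by
  rintro _ ⟨v, hv, rfl⟩ i hi
  rw [Matrix.toLin'_apply, Matrix.mulVec, dotProduct]
  refine Finset.sum_eq_zero fun j _ => ?_
  by_cases hj : (j : ℕ) < a
  · rw [hg i j (by omega), zero_mul]
  · rw [hv j (by omega), mul_zero]

theorem map_midSpace_tail {a : ℕ} {g : Matrix (Fin b) (Fin b) F}
    (hg : ∀ i j : Fin b, ¬((i : ℕ) < a ↔ (j : ℕ) < a) → g i j = 0) :
    (midSpace F b a b).map g.toLin' ≤ midSpace F b a b := by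
  rintro _ ⟨v, hv, rfl⟩ i hi
  rw [Matrix.toLin'_apply, Matrix.mulVec, dotProduct]
  refine Finset.sum_eq_zero fun j _ => ?_
  by_cases hj : (j : ℕ) < a
  · rw [hv j (by omega), mul_zero]
  · rw [hg i j (by omega), zero_mul]

theorem map_eq_of_le_of_injective {g : Matrix (Fin b) (Fin b) F} {h : Matrix (Fin b) (Fin b) F}
    (hhg : h * g = 1) {U : Submodule F (Fin b → F)} (hU : U.map g.toLin' ≤ U) :
    U.map g.toLin' = U := by
  have hinj : Function.Injective g.toLin' := by
    intro v w hvw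
    have := congrArg h.toLin' hvw
    simpa [Matrix.mulVec_mulVec, hhg] using this
  exact Submodule.eq_of_le_of_finrank_eq hU
    (Submodule.equivMapOfInjective g.toLin' hinj U).finrank_eq.symm

theorem map_relStep {a : ℕ} {A g h : Matrix (Fin b) (Fin b) F} (hhg : h * g = 1)
    (hg : ∀ i j : Fin b, ¬((i : ℕ) < a ↔ (j : ℕ) < a) → g i j = 0)
    (U : Submodule F (Fin b → F)) :
    (relStep a A U).map g.toLin' = relStep a (g * A * h) (U.map g.toLin') := by
  have hinj : Function.Injective g.toLin' := by
    intro v w hvw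
    have := congrArg h.toLin' hvw
    simpa [Matrix.mulVec_mulVec, hhg] using this
  rw [relStep, Submodule.map_inf _ hinj, map_eq_of_le_of_injective hhg (map_midSpace_tail hg),
    relStep]
  conv_rhs => rw [← map_eq_of_le_of_injective hhg (map_midSpace_head hg), ← Submodule.map_sup,
    ← Submodule.map_comp]
  rw [← Submodule.map_comp, ← Matrix.toLin'_mul, ← Matrix.toLin'_mul, mul_assoc, hhg, mul_one]

/-- The pencil `A + X E` with `E` the projector to the coordinates `≥ a`. -/
noncomputable def pencil (a : ℕ) (A : Matrix (Fin b) (Fin b) F) : Matrix (Fin b) (Fin b) F[X] :=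
  A.map C + (X : F[X]) • (tailProj F a b).map C

/-- A `g` that is block diagonal for the splitting at `a` commutes with the projector, so the whole
pencil is conjugated. -/
theorem det_pencil_conj {a : ℕ} {A g h : Matrix (Fin b) (Fin b) F} (hgh : g * h = 1)
    (hg : ∀ i j : Fin b, ¬((i : ℕ) < a ↔ (j : ℕ) < a) → g i j = 0) :
    (pencil a (g * A * h)).det = (pencil a A).det := by
  have hcomm : g * tailProj F a b = tailProj F a b * g := by
    ext i j
    rw [tailProj, Matrix.mul_diagonal, Matrix.diagonal_mul]
    by_cases hij : (i : ℕ) < a ↔ (j : ℕ) < a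
    · have : a ≤ (i : ℕ) ↔ a ≤ (j : ℕ) := by omega
      simp [this]
    · simp [hg i j hij]
  have hE : tailProj F a b = g * tailProj F a b * h := by rw [hcomm, mul_assoc, hgh, mul_one]
  have : pencil a (g * A * h) = g.map C * pencil a A * h.map C := by
    rw [pencil, pencil]
    conv_lhs => rw [hE]
    simp only [Matrix.map_mul, Matrix.mul_add, Matrix.add_mul, Matrix.mul_smul, Matrix.smul_mul]
  rw [this, Matrix.det_mul, Matrix.det_mul, mul_right_comm, ← Matrix.det_mul, ← Matrix.map_mul,
    hgh, Matrix.map_one _ (map_zero C) (map_one C), Matrix.det_one, one_mul]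

variable {a s : ℕ}

theorem sum_eq_sum_castLE (hsb : s ≤ b) {G : Type*} [AddCommMonoid G] (f : Fin b → G)
    (hf : ∀ j : Fin b, s ≤ j → f j = 0) : ∑ j, f j = ∑ j : Fin s, f (Fin.castLE hsb j) := by
  obtain ⟨r, rfl⟩ := Nat.exists_eq_add_of_le hsb
  rw [Fin.sum_univ_add, Finset.sum_eq_zero (s := Finset.univ (α := Fin r)) fun j _ => hf _ (by simp),
    add_zero]
  rfl

theorem midSpace_head_le_sup : midSpace F b 0 s ≤ midSpace F b 0 a ⊔ midSpace F b a s := by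
  intro v hv
  rw [Submodule.mem_sup]
  refine ⟨fun i => if (i : ℕ) < a then v i else 0, fun i hi => ?_,
    fun i => if (i : ℕ) < a then 0 else v i, fun i hi => ?_, ?_⟩
  · exact if_neg (by omega)
  · rcases hi with hi | hi
    · exact if_pos hi
    · simp [hv i (.inr hi)]
  · ext i
    by_cases hi : (i : ℕ) < a <;> simp [hi]

/-- The lower triangular correction making the head coordinates invariant. -/
theorem exists_lowerTriangular (hsb : s ≤ b) (has : a ≤ s) {A : Matrix (Fin b) (Fin b) F}
    (hA : relStep a A (midSpace F b a s) = midSpace F b a s) :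
    ∃ l : Matrix (Fin b) (Fin b) F, (∀ i j : Fin b, (i : ℕ) < a ∨ a ≤ j → l i j = 0) ∧
      ∀ i j : Fin b, s ≤ i → (j : ℕ) < s → ((1 + l) * A) i j = 0 := by
  -- `L i` is the `i`-th row of `A` cut off to columns below `s`. If the rows below `a` vanish on
  -- `v`, then `A` sends the truncation of `v` into the tail, hence into the fixed subspace, so the
  -- rows from `s` on vanish as well. Each of those rows is therefore a combination of the rows
  -- below `a`, and `l` subtracts it.
  let L : Fin b → (Fin b → F) →ₗ[F] F := fun i =>
    (LinearMap.proj i).comp ((A * (1 - tailProj F s b)).toLin')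
  have hLv : ∀ k v, L k v = A.mulVec ((1 - tailProj F s b).mulVec v) k := fun k v => by
    rw [Matrix.mulVec_mulVec]
    rfl
  have hhead : ∀ v : Fin b → F, (1 - tailProj F s b).mulVec v ∈ midSpace F b 0 s := by
    intro v i hi
    have : s ≤ (i : ℕ) := by omega
    simp [Matrix.sub_mulVec, tailProj, Matrix.mulVec_diagonal, this]
  have key : ∀ i : Fin b, ∃ c : Fin a → F, s ≤ (i : ℕ) →
      ∑ k, c k • L (Fin.castLE (has.trans hsb) k) = L i := by
    intro i
    by_cases hi : s ≤ (i : ℕ)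
    · have := mem_span_of_iInf_ker_le_ker (L := fun k : Fin a => L (Fin.castLE (has.trans hsb) k))
        (K := L i) (by
          intro v hv
          rw [Submodule.mem_iInf] at hv
          have hmem : A.mulVec ((1 - tailProj F s b).mulVec v) ∈ midSpace F b a s := by
            rw [← hA]
            refine ⟨fun k hk => ?_, _, midSpace_head_le_sup (hhead v), rfl⟩
            have hka : (k : ℕ) < a := by omega
            have := hv ⟨k, hka⟩
            rwa [LinearMap.mem_ker, hLv] at this
          have := hmem i (.inr hi)
          rwa [LinearMap.mem_ker, hLv])
      obtain ⟨c, hc⟩ := (Submodule.mem_span_range_iff_exists_fun F).mp this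
      exact ⟨c, fun _ => hc⟩
    · exact ⟨0, fun h => absurd h hi⟩
  choose c hc using key
  refine ⟨Matrix.of fun i j => if h : s ≤ (i : ℕ) ∧ (j : ℕ) < a then -c i ⟨j, h.2⟩ else 0, ?_, ?_⟩
  · intro i j hij
    exact dif_neg (by omega)
  · intro i j hi hj
    have hL : ∀ k, L k (Pi.single j 1) = A k j := by
      intro k
      have : (A * (1 - tailProj F s b)) k j = A k j := by
        simp [Matrix.mul_sub, tailProj, Matrix.mul_diagonal, not_le.mpr hj]
      rw [← this]
      simp only [L, LinearMap.comp_apply, Matrix.toLin'_apply, Matrix.mulVec_single_one]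
      rfl
    have := congrArg (fun φ : (Fin b → F) →ₗ[F] F => φ (Pi.single j 1)) (hc i hi)
    simp only [LinearMap.sum_apply, LinearMap.smul_apply, hL, smul_eq_mul] at this
    rw [Matrix.add_mul, Matrix.add_apply, Matrix.one_mul, Matrix.mul_apply,
      sum_eq_sum_castLE (has.trans hsb)]
    · simp [hi, this]
    · intro k hk
      rw [Matrix.of_apply, dif_neg (by omega), zero_mul]

/-- The leading block of size `s`. -/
def headBlock {F : Type*} (hsb : s ≤ b) (N : Matrix (Fin b) (Fin b) F) : Matrix (Fin s) (Fin s) F :=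
  N.submatrix (Fin.castLE hsb) (Fin.castLE hsb)

/-- The square block of rows and columns `≥ s`. -/
def tailBlock (s : ℕ) (N : Matrix (Fin b) (Fin b) F) : Matrix (Fin b) (Fin b) F :=
  Matrix.of fun i j => if s ≤ i ∧ s ≤ j then N i j else 0

theorem headBlock_mulVec (hsb : s ≤ b) (N : Matrix (Fin b) (Fin b) F) {v : Fin b → F}
    (hv : v ∈ midSpace F b 0 s) (i : Fin s) :
    (headBlock hsb N).mulVec (v ∘ Fin.castLE hsb) i = N.mulVec v (Fin.castLE hsb i) := by
  rw [Matrix.mulVec, dotProduct, Matrix.mulVec, dotProduct, sum_eq_sum_castLE hsb]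
  · rfl
  · intro j hj
    rw [hv j (.inr hj), mul_zero]

/-- The columns of `l` from `a` on vanish, so `1 + l` fixes the projector; it is also unipotent
lower triangular. -/
theorem det_pencil_one_add_mul {l A : Matrix (Fin b) (Fin b) F}
    (hl : ∀ i j : Fin b, (i : ℕ) < a ∨ a ≤ j → l i j = 0) :
    (pencil a ((1 + l) * A)).det = (pencil a A).det := by
  have hE : (1 + l) * tailProj F a b = tailProj F a b := by
    ext i j
    rw [tailProj, Matrix.mul_diagonal]
    by_cases hj : a ≤ (j : ℕ)
    · by_cases hij : i = j
      · subst hij; simp [hj, hl i i (.inr hj)]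
      · simp [hj, hij, hl i j (.inr hj)]
    · by_cases hij : i = j
      · subst hij; simp [hj]
      · simp [hj, hij]
  have hdet : ((1 + l).map C : Matrix (Fin b) (Fin b) F[X]).det = 1 := by
    rw [← RingHom.mapMatrix_apply, ← RingHom.map_det, Matrix.det_of_isLowerTriangular]
    · rw [Finset.prod_eq_one, map_one]
      intro i _
      simp [hl i i (by omega)]
    · intro i j hij
      have : i < j := hij
      simp [this.ne, hl i j (by omega)]
  have : pencil a ((1 + l) * A) = (1 + l).map C * pencil a A := by
    rw [pencil, pencil]
    conv_lhs => rw [← hE]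
    simp only [Matrix.map_mul, Matrix.mul_add, Matrix.mul_smul]
  rw [this, Matrix.det_mul, hdet, one_mul]

/-- Since `a ≤ s`, the projector is the identity on the lower block, which thus contributes `det
(N₂₂ + X) = charpoly (-N₂₂)`. -/
theorem det_pencil_blockTriangular {r : ℕ} {N : Matrix (Fin (s + r)) (Fin (s + r)) F} (has : a ≤ s)
    (hN : ∀ i j : Fin (s + r), s ≤ i → (j : ℕ) < s → N i j = 0) :
    (pencil a N).det = (pencil a (headBlock (Nat.le_add_right s r) N)).det *
      (-N.submatrix (Fin.natAdd s) (Fin.natAdd s)).charpoly := by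
  rw [← Matrix.det_submatrix_equiv_self finSumFinEquiv]
  have : (pencil a N).submatrix finSumFinEquiv finSumFinEquiv = Matrix.fromBlocks
      (pencil a (headBlock (Nat.le_add_right s r) N))
      ((pencil a N).submatrix (Fin.castAdd r) (Fin.natAdd s)) 0
      (Matrix.charmatrix (-N.submatrix (Fin.natAdd s) (Fin.natAdd s))) := by
    ext i j : 2
    rcases i with i | i <;> rcases j with j | j
    · simp [pencil, headBlock, tailProj, Matrix.diagonal_apply]
      rfl
    · simp
    · simp [pencil, hN, tailProj]
      rw [Matrix.diagonal_apply_ne _ (by simp [Fin.ext_iff]; omega)]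
      simp
    · simp [pencil, tailProj, Matrix.charmatrix_apply, Matrix.diagonal_apply]
      have : a ≤ s + (i : ℕ) := by omega
      simp [this, add_comm]
  rw [this, Matrix.det_fromBlocks_zero₂₁, Matrix.charpoly]

end Pencil

/-! ### Nilpotency from the stable subspaces of the relation -/

section Pencil

open Polynomial

variable {F : Type*} [Field F] {b a s : ℕ}

theorem sup_le_midSpace_head (has : a ≤ s) {U : Submodule F (Fin b → F)}
    (hU : U ≤ midSpace F b a s) : midSpace F b 0 a ⊔ U ≤ midSpace F b 0 s :=
  sup_le (fun _ hv i hi => hv i (by omega)) (hU.trans fun _ hv i hi => hv i (by omega))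

theorem mulVec_apply_eq_zero {m n : Type*} [Fintype n] {A : Matrix m n F} {v : n → F} {i : m}
    (h : ∀ j, A i j * v j = 0) : A.mulVec v i = 0 :=
  Finset.sum_eq_zero fun j _ => h j

theorem one_add_mulVec_of_mem {l : Matrix (Fin b) (Fin b) F}
    (hl : ∀ i j : Fin b, (i : ℕ) < a ∨ a ≤ j → l i j = 0) {u : Fin b → F}
    (hu : u ∈ midSpace F b a b) : (1 + l).mulVec u = u := by
  rw [Matrix.add_mulVec, Matrix.one_mulVec, add_eq_left]
  ext i
  refine mulVec_apply_eq_zero fun j => ?_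
  by_cases hj : (j : ℕ) < a
  · rw [hu j (.inl hj), mul_zero]
  · rw [hl i j (by omega), zero_mul]

/-- `l` changes no coordinate below `a` and kills vectors supported from `a` on. With the preceding
lemma this shows that `A` and `(1 + l) * A` have the same values in the tail space, so they define
the same relation. -/
theorem eq_of_one_add_mulVec_mem {l : Matrix (Fin b) (Fin b) F}
    (hl : ∀ i j : Fin b, (i : ℕ) < a ∨ a ≤ j → l i j = 0) {x : Fin b → F}
    (hx : (1 + l).mulVec x ∈ midSpace F b a b) : (1 + l).mulVec x = x := by
  refine one_add_mulVec_of_mem hl fun i hi => ?_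
  have h := hx i hi
  rw [Matrix.add_mulVec, Matrix.one_mulVec, Pi.add_apply] at h
  have : l.mulVec x i = 0 := mulVec_apply_eq_zero fun j => by rw [hl i j (by omega), zero_mul]
  rwa [this, add_zero] at h

theorem exists_mulVec_eq (has : a ≤ s) {l A : Matrix (Fin b) (Fin b) F}
    (hl : ∀ i j : Fin b, (i : ℕ) < a ∨ a ≤ j → l i j = 0) {U : Submodule F (Fin b → F)}
    (hU : U ≤ midSpace F b a s) {u : Fin b → F} (hu : u ∈ relStep a A U) :
    ∃ u' ∈ U, ∃ x ∈ midSpace F b 0 s, x - u' ∈ midSpace F b 0 a ∧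
      ((1 + l) * A).mulVec x = u := by
  obtain ⟨hu1, x, hx, rfl⟩ := hu
  obtain ⟨v, hv, u', hu', rfl⟩ := Submodule.mem_sup.mp hx
  refine ⟨u', hu', v + u', sup_le_midSpace_head has hU hx, by simpa using hv, ?_⟩
  rw [← Matrix.mulVec_mulVec]
  exact one_add_mulVec_of_mem hl hu1

/-- As the subspace is fixed, the range of the head block contains the basis vectors with index in
`[a, s)`. A left null vector then vanishes at these indices, so it also annihilates the projector
and hence the head block of the pencil, contradicting the nonvanishing determinant. -/
theorem det_headBlock_ne_zero (hsb : s ≤ b) (has : a ≤ s) {l A : Matrix (Fin b) (Fin b) F}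
    (hA : relStep a A (midSpace F b a s) = midSpace F b a s)
    (hl : ∀ i j : Fin b, (i : ℕ) < a ∨ a ≤ j → l i j = 0)
    (hN : ∀ i j : Fin b, s ≤ i → (j : ℕ) < s → ((1 + l) * A) i j = 0)
    (hdet : (pencil a A).det ≠ 0) : (headBlock hsb ((1 + l) * A)).det ≠ 0 := by
  set N := (1 + l) * A with hNdef
  intro h0
  obtain ⟨φ, hφ, hφN⟩ := Matrix.exists_vecMul_eq_zero_iff.mpr h0
  have hφa : ∀ i : Fin s, a ≤ i → φ i = 0 := by
    intro i hi
    have hu : (Pi.single (Fin.castLE hsb i) 1 : Fin b → F) ∈ midSpace F b a s := by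
      intro j hj
      refine Pi.single_eq_of_ne ?_ _
      rintro rfl
      simp at hj
      omega
    rw [← hA] at hu
    obtain ⟨-, -, x, hx, -, hxu⟩ := exists_mulVec_eq has hl le_rfl hu
    have h1 : (headBlock hsb N).mulVec (x ∘ Fin.castLE hsb) = Pi.single i 1 := by
      ext j
      rw [headBlock_mulVec hsb N hx, hxu]
      simp [Pi.single_apply]
    have h2 := Matrix.dotProduct_mulVec φ (headBlock hsb N) (x ∘ Fin.castLE hsb)
    rw [h1, hφN] at h2
    simpa using h2
  refine hdet ?_
  rw [← det_pencil_one_add_mul hl, ← hNdef]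
  obtain ⟨r, rfl⟩ := Nat.exists_eq_add_of_le hsb
  rw [det_pencil_blockTriangular has hN]
  refine mul_eq_zero_of_left (Matrix.exists_vecMul_eq_zero_iff.mp ⟨C ∘ φ, ?_, ?_⟩) _
  · intro h
    refine hφ (funext fun i => ?_)
    have := congrFun h i
    simpa using this
  · ext1 j
    have h1 : ∑ i, φ i * headBlock hsb N i j = 0 := congrFun hφN j
    have h2 : ∑ i, φ i * tailProj F a s i j = 0 := by
      refine Finset.sum_eq_zero fun i _ => ?_
      by_cases hi : a ≤ (i : ℕ)
      · rw [hφa i hi, zero_mul]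
      · by_cases hij : i = j
        · subst hij; simp [tailProj, hi]
        · simp [tailProj, hij]
    have h3 : ∑ i, (C (φ i) : F[X]) * pencil a (headBlock hsb N) i j =
        C (∑ i, φ i * headBlock hsb N i j) + X * C (∑ i, φ i * tailProj F a s i j) := by
      simp only [pencil, Matrix.add_apply, Matrix.smul_apply, Matrix.map_apply, smul_eq_mul,
        mul_add, Finset.sum_add_distrib, map_sum, map_mul, Finset.mul_sum]
      congr 1
      exact Finset.sum_congr rfl fun i _ => by ring
    rw [h1, h2, map_zero, mul_zero, add_zero] at h3
    exact h3

/-- Extension of a vector by zero. -/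
def extendVec (b : ℕ) (w : Fin s → F) : Fin b → F :=
  fun i => if h : (i : ℕ) < s then w ⟨i, h⟩ else 0

theorem extendVec_mem (w : Fin s → F) : extendVec b w ∈ midSpace F b 0 s :=
  fun _ hi => dif_neg (by omega)

theorem extendVec_comp (hsb : s ≤ b) (w : Fin s → F) : extendVec b w ∘ Fin.castLE hsb = w := by
  ext i
  simp [extendVec]

/-- The tail block acts as a selection of the relation: any vector of `U` can be altered by head and
`[a, s)` coordinates so that `N` maps it exactly to the value of the tail block. -/
theorem tailBlock_mulVec_mem (hsb : s ≤ b) (has : a ≤ s) {l A : Matrix (Fin b) (Fin b) F}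
    (hl : ∀ i j : Fin b, (i : ℕ) < a ∨ a ≤ j → l i j = 0)
    (hN : ∀ i j : Fin b, s ≤ i → (j : ℕ) < s → ((1 + l) * A) i j = 0)
    {K : Matrix (Fin s) (Fin s) F} (hK : headBlock hsb ((1 + l) * A) * K = 1)
    {U : Submodule F (Fin b → F)} (hU : midSpace F b a s ≤ U) (hU' : U ≤ midSpace F b a b)
    {u : Fin b → F} (hu : u ∈ U) : (tailBlock s ((1 + l) * A)).mulVec u ∈ relStep a A U := by
  set N := (1 + l) * A with hNdef
  set v : Fin b → F := fun i => if s ≤ (i : ℕ) then u i else 0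
  have hv : v ∈ U := by
    have : u - v ∈ midSpace F b a s := by
      rintro i (hi | hi)
      · simp [v, hU' hu i (.inl hi)]
      · simp [v, hi]
    have := U.sub_mem hu (hU this)
    simpa using this
  have hBu : ∀ i, (tailBlock s N).mulVec u i = if s ≤ (i : ℕ) then N.mulVec v i else 0 := by
    intro i
    by_cases hi : s ≤ (i : ℕ)
    · rw [if_pos hi]
      rw [Matrix.mulVec, dotProduct, Matrix.mulVec, dotProduct]
      refine Finset.sum_congr rfl fun j _ => ?_
      by_cases hj : s ≤ (j : ℕ) <;> simp [tailBlock, v, hi, hj]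
    · rw [if_neg hi]
      exact mulVec_apply_eq_zero fun j => by simp [tailBlock, hi]
  -- `w` is supported below `s` and chosen so that `N w` matches `N v` in the first `s` coordinates.
  -- The zero lower left block keeps the remaining coordinates of `N v` unchanged.
  set w := extendVec b (K.mulVec (N.mulVec v ∘ Fin.castLE hsb))
  have hw : w ∈ midSpace F b 0 s := extendVec_mem _
  have hNw : ∀ i, N.mulVec w i = if s ≤ (i : ℕ) then 0 else N.mulVec v i := by
    intro i
    by_cases hi : s ≤ (i : ℕ)
    · rw [if_pos hi]
      refine mulVec_apply_eq_zero fun j => ?_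
      by_cases hj : s ≤ (j : ℕ)
      · rw [hw j (.inr hj), mul_zero]
      · rw [hN i j hi (not_le.mp hj), zero_mul]
    · rw [if_neg hi]
      have := headBlock_mulVec hsb N hw ⟨i, not_le.mp hi⟩
      rw [extendVec_comp, Matrix.mulVec_mulVec, hK, Matrix.one_mulVec] at this
      exact this.symm
  have hNvw : N.mulVec (v - w) = (tailBlock s N).mulVec u := by
    ext i
    rw [Matrix.mulVec_sub, Pi.sub_apply, hBu, hNw]
    split_ifs <;> simp
  have htail : (tailBlock s N).mulVec u ∈ midSpace F b a b := by
    intro i hi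
    rw [hBu, if_neg (by omega)]
  refine ⟨htail, v - w, ?_, ?_⟩
  · exact Submodule.sub_mem _ (Submodule.mem_sup_right hv)
      (sup_le_sup_left hU _ (midSpace_head_le_sup hw))
  · rw [← hNvw, hNdef, ← Matrix.mulVec_mulVec] at htail ⊢
    exact (eq_of_one_add_mulVec_mem hl htail).symm

theorem midSpace_le_iterate {A : Matrix (Fin b) (Fin b) F}
    (hA : relStep a A (midSpace F b a s) = midSpace F b a s) (t : ℕ) :
    midSpace F b a s ≤ (relStep a A)^[t] (midSpace F b a b) := by
  rw [← Function.iterate_fixed hA t]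
  exact (relStep_mono a A).iterate t (hA ▸ relStep_le a A _)

theorem iterate_le_midSpace {A : Matrix (Fin b) (Fin b) F}
    (hA : relStep a A (midSpace F b a s) = midSpace F b a s) (t : ℕ) :
    (relStep a A)^[t] ⊥ ≤ midSpace F b a s := by
  conv_rhs => rw [← Function.iterate_fixed hA t]
  exact (relStep_mono a A).iterate t bot_le

/-- One application lands in the tail space, `n` more descend along the iterates to the stable
subspace, and the last one kills it, because the tail block has no columns below `s`. -/
theorem tailBlock_pow_eq_zero (hsb : s ≤ b) (has : a ≤ s) {l A : Matrix (Fin b) (Fin b) F}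
    (hA : relStep a A (midSpace F b a s) = midSpace F b a s)
    (hl : ∀ i j : Fin b, (i : ℕ) < a ∨ a ≤ j → l i j = 0)
    (hN : ∀ i j : Fin b, s ≤ i → (j : ℕ) < s → ((1 + l) * A) i j = 0)
    {K : Matrix (Fin s) (Fin s) F} (hK : headBlock hsb ((1 + l) * A) * K = 1) {n : ℕ}
    (hn : (relStep a A)^[n] (midSpace F b a b) = midSpace F b a s) :
    tailBlock s ((1 + l) * A) ^ (n + 2) = 0 := by
  set B := tailBlock s ((1 + l) * A)
  have hmem : ∀ t, ∀ u ∈ midSpace F b a b,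
      (B ^ t).mulVec u ∈ (relStep a A)^[t] (midSpace F b a b) := by
    intro t
    induction t with
    | zero => simp
    | succ t ih =>
      intro u hu
      rw [pow_succ', ← Matrix.mulVec_mulVec, Function.iterate_succ_apply']
      refine tailBlock_mulVec_mem hsb has hl hN hK (midSpace_le_iterate hA t) ?_ (ih u hu)
      cases t with
      | zero => exact le_rfl
      | succ t => rw [Function.iterate_succ_apply']; exact relStep_le _ _ _
  have hzero : ∀ u ∈ midSpace F b a s, B.mulVec u = 0 := by
    intro u hu
    ext i
    refine mulVec_apply_eq_zero fun j => ?_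
    by_cases hj : s ≤ (j : ℕ)
    · rw [hu j (.inr hj), mul_zero]
    · simp [B, tailBlock, hj]
  have hB : ∀ v, B.mulVec v ∈ midSpace F b a b := fun v i hi =>
    mulVec_apply_eq_zero fun j => by simp [B, tailBlock, show ¬ s ≤ (i : ℕ) by omega]
  refine Matrix.ext_of_mulVec_single fun i => ?_
  rw [pow_succ, pow_succ', ← Matrix.mulVec_mulVec, ← Matrix.mulVec_mulVec, Matrix.zero_mulVec]
  exact hzero _ (hn ▸ hmem n _ (hB _))

/-- The projector times `K` inverts the relation: for `u = N x` with `x` equal to `u'` up to head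
coordinates, `K u = x` and the projector returns `u'`. It therefore descends the chain of iterates
from `⊥`; the extra application brings an arbitrary vector into the stable subspace. -/
theorem tailProj_mul_pow_eq_zero (hsb : s ≤ b) (has : a ≤ s) {l A : Matrix (Fin b) (Fin b) F}
    (hA : relStep a A (midSpace F b a s) = midSpace F b a s)
    (hl : ∀ i j : Fin b, (i : ℕ) < a ∨ a ≤ j → l i j = 0)
    {K : Matrix (Fin s) (Fin s) F} (hK : K * headBlock hsb ((1 + l) * A) = 1) {n : ℕ}
    (hn : (relStep a A)^[n] ⊥ = midSpace F b a s) :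
    (tailProj F a s * K) ^ (n + 1) = 0 := by
  have hmem : ∀ t, ∀ u ∈ (relStep a A)^[t] ⊥,
      ((tailProj F a s * K) ^ t).mulVec (u ∘ Fin.castLE hsb) = 0 := by
    intro t
    induction t with
    | zero =>
      intro u hu
      have : u = 0 := by simpa using hu
      subst this
      simp
    | succ t ih =>
      intro u hu
      rw [Function.iterate_succ_apply'] at hu
      obtain ⟨u', hu', x, hx, hxu', rfl⟩ := exists_mulVec_eq has hl (iterate_le_midSpace hA t) hu
      have h1 : K.mulVec (((1 + l) * A).mulVec x ∘ Fin.castLE hsb) = x ∘ Fin.castLE hsb := by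
        have : ((1 + l) * A).mulVec x ∘ Fin.castLE hsb =
            (headBlock hsb ((1 + l) * A)).mulVec (x ∘ Fin.castLE hsb) := by
          ext i
          rw [headBlock_mulVec hsb _ hx]
          rfl
        rw [this, Matrix.mulVec_mulVec, hK, Matrix.one_mulVec]
      have h2 : (tailProj F a s).mulVec (x ∘ Fin.castLE hsb) = u' ∘ Fin.castLE hsb := by
        ext i
        rw [tailProj, Matrix.mulVec_diagonal]
        by_cases hi : a ≤ (i : ℕ)
        · have := hxu' (Fin.castLE hsb i) (.inr hi)
          simpa [hi, sub_eq_zero] using this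
        · have := iterate_le_midSpace hA t hu' (Fin.castLE hsb i) (.inl (not_le.mp hi))
          simp [hi, this]
      rw [pow_succ, ← Matrix.mulVec_mulVec, ← Matrix.mulVec_mulVec, h1, h2, ih u' hu']
  refine Matrix.ext_of_mulVec_single fun i => ?_
  rw [pow_succ, ← Matrix.mulVec_mulVec, Matrix.zero_mulVec]
  have h := hmem n (extendVec b ((tailProj F a s * K).mulVec (Pi.single i 1))) (by
    rw [hn]
    rintro j (hj | hj)
    · by_cases hjs : (j : ℕ) < s
      · rw [extendVec, dif_pos hjs, ← Matrix.mulVec_mulVec, tailProj, Matrix.mulVec_diagonal]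
        simp [not_le.mpr hj]
      · exact dif_neg hjs
    · exact dif_neg (not_lt.mpr hj))
  rwa [extendVec_comp] at h

end Pencil

/-! ### Normal form of the residue matrix at a vertex -/

section GoodForm

open Polynomial

variable {F : Type*} [Field F] {b a s : ℕ}

theorem exists_iterate_fixed_of_le {α : Type*} [PartialOrder α] [WellFoundedGT α] {f : α → α}
    (hf : Monotone f) {x : α} (hx : x ≤ f x) : ∃ n, f (f^[n] x) = f^[n] x := by
  obtain ⟨n, hn⟩ := WellFoundedGT.monotone_chain_condition
    (⟨fun n => f^[n] x, hf.monotone_iterate_of_le_map hx⟩ : ℕ →o α)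
  exact ⟨n, (Function.iterate_succ_apply' f n x).symm.trans (hn (n + 1) (Nat.le_succ n)).symm⟩

theorem exists_iterate_fixed_of_ge {α : Type*} [PartialOrder α] [WellFoundedLT α] {f : α → α}
    (hf : Monotone f) {x : α} (hx : f x ≤ x) : ∃ n, f (f^[n] x) = f^[n] x :=
  exists_iterate_fixed_of_le (α := αᵒᵈ) (f := f) hf.dual (x := x) hx

theorem tailBlock_pow_submatrix {r : ℕ} (N : Matrix (Fin (s + r)) (Fin (s + r)) F) (k : ℕ) :
    (tailBlock s N ^ k).submatrix (Fin.natAdd s) (Fin.natAdd s) =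
      N.submatrix (Fin.natAdd s) (Fin.natAdd s) ^ k := by
  induction k with
  | zero =>
    ext i j
    simp [Matrix.one_apply]
  | succ k ih =>
    rw [pow_succ, pow_succ, ← ih]
    ext i j
    rw [Matrix.submatrix_apply, Matrix.mul_apply, Fin.sum_univ_add, Matrix.mul_apply,
      Finset.sum_eq_zero (s := Finset.univ (α := Fin s)), zero_add]
    · simp [tailBlock]
    · intro l _
      simp [tailBlock]

theorem charpoly_eq_X_pow {r : ℕ} {S : Matrix (Fin r) (Fin r) F} (hS : IsNilpotent S) :
    S.charpoly = X ^ r := by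
  have := (Matrix.isNilpotent_charpoly_sub_pow_of_isNilpotent hS).eq_zero
  rwa [Fintype.card_fin, sub_eq_zero] at this

/-- The lower block contributes exactly `X ^ r`, and the cofactor has constant term `det` of the
head block; so the order of vanishing at zero is `r`. -/
theorem coeff_det_pencil_of_tailBlock {r : ℕ} {N : Matrix (Fin (s + r)) (Fin (s + r)) F}
    (has : a ≤ s) (hN : ∀ i j : Fin (s + r), s ≤ i → (j : ℕ) < s → N i j = 0)
    (hdet : (headBlock (Nat.le_add_right s r) N).det ≠ 0) {k : ℕ} (hk : tailBlock s N ^ k = 0) :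
    (pencil a N).det.coeff r ≠ 0 ∧ ∀ j < r, (pencil a N).det.coeff j = 0 := by
  have hnil : IsNilpotent (-N.submatrix (Fin.natAdd s) (Fin.natAdd s)) :=
    IsNilpotent.neg ⟨k, by rw [← tailBlock_pow_submatrix, hk]; rfl⟩
  rw [det_pencil_blockTriangular has hN, charpoly_eq_X_pow hnil]
  constructor
  · have h0 : (pencil a (headBlock (Nat.le_add_right s r) N)).det.coeff 0 =
        (headBlock (Nat.le_add_right s r) N).det := by
      rw [Polynomial.coeff_zero_eq_eval_zero, ← Polynomial.coe_evalRingHom, RingHom.map_det]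
      congr 1
      ext i j
      simp [pencil]
    have := Polynomial.coeff_mul_X_pow (pencil a (headBlock (Nat.le_add_right s r) N)).det r 0
    rw [zero_add] at this
    rw [this, h0]
    exact hdet
  · intro j hj
    rw [Polynomial.coeff_mul_X_pow', if_neg (not_le.mpr hj)]

/-- With `H` the head block and `E` the projector, the pencil of `H` is `H (1 + X K E)`. As `K E` is
nilpotent, its determinant is a unit, so the degree comes from the monic characteristic polynomial
of size `r`. -/
theorem natDegree_det_pencil_of_tailProj {r : ℕ} {N : Matrix (Fin (s + r)) (Fin (s + r)) F}
    (has : a ≤ s) (hN : ∀ i j : Fin (s + r), s ≤ i → (j : ℕ) < s → N i j = 0)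
    {K : Matrix (Fin s) (Fin s) F} (hK : headBlock (Nat.le_add_right s r) N * K = 1) {k : ℕ}
    (hk : (tailProj F a s * K) ^ k = 0) : (pencil a N).det.natDegree = r := by
  set H := headBlock (Nat.le_add_right s r) N
  have hKnil : (K * tailProj F a s) ^ (k + 1) = 0 := by
    have : ∀ k, (K * tailProj F a s) ^ (k + 1) =
        K * (tailProj F a s * K) ^ k * tailProj F a s := by
      intro k
      induction k with
      | zero => simp
      | succ k ih => rw [pow_succ, ih, pow_succ]; simp only [mul_assoc]
    rw [this, hk, mul_zero, zero_mul]
  have hrev := Matrix.isUnit_charpolyRev_of_isNilpotent (M := -(K * tailProj F a s))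
    (IsNilpotent.neg ⟨_, hKnil⟩)
  have hpen : pencil a H = H.map C * (1 - (X : F[X]) • (-(K * tailProj F a s)).map C) := by
    have h1 : (-(K * tailProj F a s)).map (C : F → F[X]) = -(K.map C * (tailProj F a s).map C) := by
      rw [← Matrix.map_mul]
      ext1 i j
      simp only [Matrix.map_apply, Matrix.neg_apply, map_neg]
    rw [h1, smul_neg, sub_neg_eq_add, mul_add, mul_one, pencil, Matrix.mul_smul, ← mul_assoc,
      ← Matrix.map_mul, hK, Matrix.map_one _ (map_zero C) (map_one C), one_mul]
  have hHdet : H.det ≠ 0 := by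
    intro h0
    have := congrArg Matrix.det hK
    rw [Matrix.det_mul, h0, zero_mul, Matrix.det_one] at this
    exact zero_ne_one this
  have hHunit : IsUnit (H.map (C : F → F[X])).det := by
    have : (H.map (C : F → F[X])).det = C H.det := by
      rw [RingHom.map_det]
      rfl
    rw [this, Polynomial.isUnit_C]
    exact hHdet.isUnit
  have hunit : IsUnit (pencil a H).det := by
    rw [hpen, Matrix.det_mul]
    exact hHunit.mul hrev
  rw [det_pencil_blockTriangular has hN, Polynomial.natDegree_mul hunit.ne_zero
    (Matrix.charpoly_monic _).ne_zero, Polynomial.natDegree_eq_zero_of_isUnit hunit,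
    Matrix.charpoly_natDegree_eq_dim, Fintype.card_fin, zero_add]

/-- Normal form of a matrix at a vertex of its pencil. -/
theorem exists_goodForm (has : a ≤ s) (hsb : s ≤ b) {A : Matrix (Fin b) (Fin b) F}
    (hs : (pencil a A).det.coeff (b - s) ≠ 0)
    (hvertex : (∀ j < b - s, (pencil a A).det.coeff j = 0) ∨
      ∀ j, b - s < j → j ≤ b - a → (pencil a A).det.coeff j = 0) :
    ∃ g h l : Matrix (Fin b) (Fin b) F, g * h = 1 ∧ h * g = 1 ∧
      (∀ i j : Fin b, (i : ℕ) < a ∨ (j : ℕ) < a → g i j = (1 : Matrix (Fin b) (Fin b) F) i j) ∧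
      (∀ i j : Fin b, (i : ℕ) < a ∨ a ≤ j → l i j = 0) ∧
      (∀ i j : Fin b, s ≤ i → (j : ℕ) < s → ((1 + l) * (g * A * h)) i j = 0) ∧
      ∃ K, headBlock hsb ((1 + l) * (g * A * h)) * K = 1 ∧
        K * headBlock hsb ((1 + l) * (g * A * h)) = 1 ∧
        ∃ k, tailBlock s ((1 + l) * (g * A * h)) ^ k = 0 ∨ (tailProj F a s * K) ^ k = 0 := by
  have hdet0 : (pencil a A).det ≠ 0 := fun h => hs (by rw [h, Polynomial.coeff_zero])
  -- The two cases of the vertex condition differ only in the seed `U₀` of the iteration. The size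
  -- `s'` is read off from the stable subspace and compared with `s` afterwards through the
  -- unchanged pencil determinant.
  have reduce : ∀ U₀ n, (relStep a A) ((relStep a A)^[n] U₀) = (relStep a A)^[n] U₀ →
      ∃ g h l : Matrix (Fin b) (Fin b) F, g * h = 1 ∧ h * g = 1 ∧
      (∀ i j : Fin b, (i : ℕ) < a ∨ (j : ℕ) < a → g i j = (1 : Matrix (Fin b) (Fin b) F) i j) ∧
      (∀ i j : Fin b, (i : ℕ) < a ∨ a ≤ j → l i j = 0) ∧
      ∃ (s' : ℕ) (hsb' : s' ≤ b), a ≤ s' ∧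
      (∀ i j : Fin b, s' ≤ i → (j : ℕ) < s' → ((1 + l) * (g * A * h)) i j = 0) ∧
      relStep a (g * A * h) (midSpace F b a s') = midSpace F b a s' ∧
      (relStep a (g * A * h))^[n] (U₀.map g.toLin') = midSpace F b a s' ∧
      (∃ K, headBlock hsb' ((1 + l) * (g * A * h)) * K = 1 ∧
        K * headBlock hsb' ((1 + l) * (g * A * h)) = 1) ∧
      (pencil a ((1 + l) * (g * A * h))).det = (pencil a A).det := by
    intro U₀ n hn
    obtain ⟨g, h, hgh, hhg, hg1, s', has', hsb', hU⟩ := exists_baseChange (has.trans hsb)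
      (hn ▸ relStep_le a A _ : (relStep a A)^[n] U₀ ≤ midSpace F b a b)
    have hg := eq_zero_of_eq_one_of_head hg1
    have hstep : ∀ U, (relStep a A U).map g.toLin' = relStep a (g * A * h) (U.map g.toLin') :=
      map_relStep hhg hg
    have hfix : relStep a (g * A * h) (midSpace F b a s') = midSpace F b a s' := by
      rw [← hU, ← hstep, hn]
    obtain ⟨l, hl, hN⟩ := exists_lowerTriangular hsb' has' hfix
    have hpen := det_pencil_conj (A := A) hgh hg
    have hdet := det_headBlock_ne_zero hsb' has' hfix hl hN (hpen ▸ hdet0)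
    refine ⟨g, h, l, hgh, hhg, hg1, hl, s', hsb', has', hN, hfix, ?_,
      ⟨_, Matrix.mul_nonsing_inv _ hdet.isUnit, Matrix.nonsing_inv_mul _ hdet.isUnit⟩, ?_⟩
    · rw [← hU]
      have hsemi : Function.Semiconj (Submodule.map g.toLin') (relStep a A)
        (relStep a (g * A * h)) := hstep
      exact ((hsemi.iterate_right n).eq U₀).symm
    · rw [det_pencil_one_add_mul hl, hpen]
  rcases hvertex with hv | hv
  · obtain ⟨n, hn⟩ := exists_iterate_fixed_of_ge (relStep_mono a A)
      (relStep_le a A (midSpace F b a b))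
    obtain ⟨g, h, l, hgh, hhg, hg, hl, s', hsb', has', hN, hfix, hit, ⟨K, hK, hK'⟩, hpen⟩ :=
      reduce _ n hn
    rw [map_eq_of_le_of_injective hhg (map_midSpace_tail (eq_zero_of_eq_one_of_head hg))] at hit
    have hnil := tailBlock_pow_eq_zero hsb' has' hfix hl hN hK hit
    -- The lowest exponent of the pencil determinant is `b - s'` by the normal form and `b - s` by
    -- hypothesis.
    obtain rfl : s' = s := by
      obtain ⟨r, rfl⟩ := Nat.exists_eq_add_of_le hsb'
      have hdet : (headBlock hsb' ((1 + l) * (g * A * h))).det ≠ 0 := by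
        intro h0
        have := congrArg Matrix.det hK
        rw [Matrix.det_mul, h0, zero_mul, Matrix.det_one] at this
        exact zero_ne_one this
      obtain ⟨h1, h2⟩ := coeff_det_pencil_of_tailBlock has' hN hdet hnil
      rw [hpen] at h1 h2
      have h3 : ¬ r < s' + r - s := fun hlt => h1 (hv r hlt)
      have h4 : ¬ s' + r - s < r := fun hlt => hs (h2 _ hlt)
      omega
    exact ⟨g, h, l, hgh, hhg, hg, hl, hN, K, hK, hK', _, .inl hnil⟩
  · obtain ⟨n, hn⟩ := exists_iterate_fixed_of_le (relStep_mono a A) (x := ⊥) bot_le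
    obtain ⟨g, h, l, hgh, hhg, hg, hl, s', hsb', has', hN, hfix, hit, ⟨K, hK, hK'⟩, hpen⟩ :=
      reduce _ n hn
    rw [Submodule.map_bot] at hit
    have hnil := tailProj_mul_pow_eq_zero hsb' has' hfix hl hK' hit
    -- Here the degree of the pencil determinant is compared: `b - s'` by the normal form, `b - s`
    -- by hypothesis.
    obtain rfl : s' = s := by
      obtain ⟨r, rfl⟩ := Nat.exists_eq_add_of_le hsb'
      have h1 := natDegree_det_pencil_of_tailProj has' hN hK hnil
      rw [hpen] at h1
      have h2 : (pencil a A).det.coeff r ≠ 0 := by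
        have := Polynomial.leadingCoeff_ne_zero.mpr hdet0
        rwa [Polynomial.leadingCoeff, h1] at this
      have h3 : ¬ s' + r - s < r := fun hlt => h2 (hv r hlt (by omega))
      have h4 := Polynomial.le_natDegree_of_ne_zero hs
      omega
    exact ⟨g, h, l, hgh, hhg, hg, hl, hN, K, hK, hK', _, .inr hnil⟩

end GoodForm

/-! ### Coefficients of the pencil determinant as sums of minors -/

section Minors

open Polynomial

variable {F : Type*} [Field F] {a b : ℕ}

/-- Multilinear expansion in the rows: for each `S`, rows in `S` come from `A` and the others from
`X E`. The latter vanish below `a`, which forces `S` to contain `[0, a)`, and contribute `X ^ (b -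
S.card)`. -/
theorem coeff_det_pencil (A : Matrix (Fin b) (Fin b) F) {k : ℕ} (hk : k ≤ b) :
    (pencil a A).det.coeff (b - k) = ∑ S ∈ Finset.univ.powersetCard k,
      if ∀ i : Fin b, (i : ℕ) < a → i ∈ S then
        (A.submatrix (Subtype.val : S → Fin b) (Subtype.val : S → Fin b)).det else 0 := by
  let D := (Matrix.detRowAlternating : (Fin b → F[X]) [⋀^Fin b]→ₗ[F[X]] F[X])
  let c : Fin b → F[X] := fun i => if a ≤ (i : ℕ) then X else 0
  have hrow : pencil a A = (fun i => A.map (C : F → F[X]) i) +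
      (fun i => c i • (1 : Matrix (Fin b) (Fin b) F[X]) i) := by
    ext1 i j
    by_cases hij : i = j
    · subst hij
      by_cases hi : a ≤ (i : ℕ) <;> simp [pencil, tailProj, c, hi]
    · simp [pencil, tailProj, hij]
  have hprod : ∀ S : Finset (Fin b), (∏ i, if i ∈ S then (1 : F[X]) else c i) =
      if ∀ i : Fin b, (i : ℕ) < a → i ∈ S then X ^ (b - S.card) else 0 := by
    intro S
    split_ifs with h
    · rw [Finset.prod_ite, Finset.prod_const_one, one_mul,
        Finset.prod_congr rfl (g := fun _ => (X : F[X])), Finset.prod_const]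
      · congr 1
        rw [Finset.filter_not, Finset.filter_mem_eq_inter, Finset.univ_inter,
          Finset.card_univ_sdiff, Fintype.card_fin]
      · intro i hi
        have hi' : i ∉ S := by simpa using hi
        exact if_pos (by by_contra hcon; exact hi' (h i (not_le.mp hcon)))
    · push Not at h
      obtain ⟨i, hi, hiS⟩ := h
      exact Finset.prod_eq_zero (Finset.mem_univ i) (by simp [hiS, c, not_le.mpr hi])
  have hterm : ∀ S : Finset (Fin b), D (S.piecewise (fun i => A.map (C : F → F[X]) i)
      (fun i => c i • (1 : Matrix (Fin b) (Fin b) F[X]) i)) =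
      (if ∀ i : Fin b, (i : ℕ) < a → i ∈ S then X ^ (b - S.card) else 0) *
        C (A.submatrix (Subtype.val : S → Fin b) (Subtype.val : S → Fin b)).det := by
    intro S
    have h1 : S.piecewise (fun i => A.map (C : F → F[X]) i)
        (fun i => c i • (1 : Matrix (Fin b) (Fin b) F[X]) i) = fun i =>
        (if i ∈ S then (1 : F[X]) else c i) • S.piecewise (A.map (C : F → F[X])).row
          (1 : Matrix (Fin b) (Fin b) F[X]).row i := by
      funext i
      by_cases hi : i ∈ S <;> simp [hi] <;> rfl
    rw [h1, D.map_smul_univ, hprod, smul_eq_mul]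
    congr 1
    refine (Matrix.det_piecewise_one_eq_submatrix_det (A.map (C : F → F[X])) S).trans ?_
    rw [RingHom.map_det]
    rfl
  have hdet : (pencil a A).det = ∑ S : Finset (Fin b),
      (if ∀ i : Fin b, (i : ℕ) < a → i ∈ S then X ^ (b - S.card) else 0) *
        C (A.submatrix (Subtype.val : S → Fin b) (Subtype.val : S → Fin b)).det := by
    rw [hrow]
    refine (D.map_add_univ _ _).trans ?_
    exact Finset.sum_congr rfl fun S _ => hterm S
  rw [hdet, Polynomial.finsetSum_coeff]
  have hset : Finset.univ.powersetCard k = Finset.univ.filter fun S : Finset (Fin b) => S.card = k := by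
    ext S
    simp [Finset.mem_powersetCard]
  rw [hset, Finset.sum_filter]
  refine Finset.sum_congr rfl fun S _ => ?_
  have hS : S.card ≤ b := by simpa using S.card_le_univ
  by_cases hcond : ∀ i : Fin b, (i : ℕ) < a → i ∈ S
  · rw [if_pos hcond, if_pos hcond, Polynomial.coeff_mul_C, Polynomial.coeff_X_pow]
    by_cases hk' : S.card = k
    · simp [hk']
    · rw [if_neg hk', if_neg (by omega), zero_mul]
  · rw [if_neg hcond, if_neg hcond]
    simp

end Minors

/-! ### Newton function on a segment of constant slope -/

section Newton

variable {F : Type*} [Field F] {a b c : ℕ} {lam : ℕ → ℕ}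

theorem le_orderEmb_apply {k : ℕ} (f : Fin k ↪o ℕ) (i : Fin k) : (i : ℕ) ≤ f i := by
  obtain ⟨i, hi⟩ := i
  induction i with
  | zero => exact Nat.zero_le _
  | succ i ih =>
    have h1 := ih (by omega)
    have h2 : f ⟨i, by omega⟩ < f ⟨i + 1, hi⟩ := f.strictMono (by simp [Fin.lt_def])
    simp only at h1 ⊢
    omega

/-- Subsets containing `[0, a)` and contained in `[0, b)` have the minimal weight. -/
theorem sum_orderEmb_eq (hconst : ∀ i, a ≤ i → i < b → lam i = c) {k : ℕ} (hak : a ≤ k)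
    (hkb : k ≤ b) {f : Fin k ↪o ℕ} (hfb : ∀ i, f i < b) (hfa : ∀ n < a, ∃ i, f i = n) :
    ∑ i, lam (f i) = ∑ i ∈ Finset.range k, lam i := by
  have key : ∀ S : Finset ℕ, Finset.range a ⊆ S → S ⊆ Finset.range b →
      ∑ n ∈ S, lam n = (S.card - a) * c + ∑ n ∈ Finset.range a, lam n := by
    intro S h1 h2
    rw [← Finset.sum_sdiff h1, Finset.sum_congr rfl (g := fun _ => c), Finset.sum_const,
      Finset.card_sdiff_of_subset h1, Finset.card_range, smul_eq_mul]
    intro n hn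
    simp only [Finset.mem_sdiff, Finset.mem_range] at hn
    exact hconst n (by omega) (Finset.mem_range.mp (h2 hn.1))
  have hf : ∑ i, lam (f i) = ∑ n ∈ Finset.univ.map f.toEmbedding, lam n := by
    rw [Finset.sum_map]
    rfl
  rw [hf, key _ _ _, key (Finset.range k) (by simpa using hak) (by simpa using hkb)]
  · simp
  · intro n hn
    obtain ⟨i, hi⟩ := hfa n (Finset.mem_range.mp hn)
    exact Finset.mem_map.mpr ⟨i, Finset.mem_univ _, hi⟩
  · intro n hn
    obtain ⟨i, -, rfl⟩ := Finset.mem_map.mp hn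
    exact Finset.mem_range.mpr (hfb i)

/-- All other subsets have larger weight. -/
theorem sum_lt_sum_orderEmb (hmono : Monotone lam) (hlow : ∀ i, i < a → lam i < c)
    (hconst : ∀ i, a ≤ i → i < b → lam i = c) (hhigh : ∀ i, b ≤ i → c < lam i) {k : ℕ}
    (hak : a ≤ k) (hkb : k ≤ b) {f : Fin k ↪o ℕ}
    (hf : ¬((∀ i, f i < b) ∧ ∀ n < a, ∃ i, f i = n)) :
    ∑ i ∈ Finset.range k, lam i < ∑ i, lam (f i) := by
  rw [← Fin.sum_univ_eq_sum_range]
  refine Finset.sum_lt_sum (fun i _ => hmono (le_orderEmb_apply f i)) ?_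
  by_contra hcon
  push Not at hcon
  refine hf ⟨fun i => ?_, fun n hn => ?_⟩
  · by_contra hi
    have h1 := hcon i (Finset.mem_univ _)
    have h2 := hhigh (f i) (not_lt.mp hi)
    by_cases hia : (i : ℕ) < a
    · have := hlow i hia
      omega
    · have := hconst i (not_lt.mp hia) (by omega)
      omega
  · have hfa : ∀ i : Fin a, f (Fin.castLE hak i) < a := by
      intro i
      by_contra hi
      have h1 := hcon (Fin.castLE hak i) (Finset.mem_univ _)
      have h2 := hlow i i.2
      have h3 : c ≤ lam (f (Fin.castLE hak i)) := by
        by_cases hib : f (Fin.castLE hak i) < b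
        · exact (hconst _ (not_lt.mp hi) hib).ge
        · exact (hhigh _ (not_lt.mp hib)).le
      simp only [Fin.val_castLE] at h1
      omega
    have hinj : Function.Injective fun i : Fin a => (⟨f (Fin.castLE hak i), hfa i⟩ : Fin a) := by
      intro i j hij
      have := f.injective (Fin.mk.inj_iff.mp hij)
      exact Fin.castLE_injective hak this
    obtain ⟨i, hi⟩ := Finite.injective_iff_surjective.mp hinj ⟨n, hn⟩
    exact ⟨_, Fin.mk.inj_iff.mp hi⟩

theorem det_submatrix_pow_mul {M M' : Matrix ℕ ℕ (PowerSeries F)}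
    (hM : ∀ i j, M i j = PowerSeries.X ^ lam i * M' i j) {k : ℕ} (f : Fin k ↪o ℕ) :
    (M.submatrix f f).det = PowerSeries.X ^ (∑ i, lam (f i)) * (M'.submatrix f f).det := by
  rw [← Finset.prod_pow_eq_pow_sum, ← Matrix.det_mul_column]
  congr 1
  ext1 i j
  simp [hM]

/-- Every principal minor of size `k` is divisible by `X ^ ∑ lam (f i)`. The exponent is minimal
exactly for index sets between `[0, a)` and `[0, b)`, and these are the sets that occur in the
pencil coefficient. -/
theorem coeff_principalMinorSum (hmono : Monotone lam) (hlow : ∀ i, i < a → lam i < c)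
    (hconst : ∀ i, a ≤ i → i < b → lam i = c) (hhigh : ∀ i, b ≤ i → c < lam i)
    {M M' : Matrix ℕ ℕ (PowerSeries F)} (hM : ∀ i j, M i j = PowerSeries.X ^ lam i * M' i j)
    {k : ℕ} (hak : a ≤ k) (hkb : k ≤ b) :
    PowerSeries.coeff (∑ i ∈ Finset.range k, lam i) (principalMinorSum M k) =
      (pencil a (Matrix.of fun i j : Fin b => PowerSeries.constantCoeff (M' i j))).det.coeff
        (b - k) := by
  classical
  rw [coeff_det_pencil _ hkb, principalMinorSum, PowerSeries.coeff_mk]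
  let φ : {S // S ∈ (Finset.univ : Finset (Fin b)).powersetCard k} → (Fin k ↪o ℕ) := fun S =>
    (S.1.orderEmbOfFin (Finset.mem_powersetCard.mp S.2).2).trans (Fin.valOrderEmb b)
  have hφ : ∀ S, Set.range (φ S) = Fin.val '' (S.1 : Set (Fin b)) := by
    intro S
    rw [← Finset.range_orderEmbOfFin S.1 (Finset.mem_powersetCard.mp S.2).2, ← Set.range_comp]
    rfl
  have hinj : Function.Injective φ := by
    intro S S' h
    have h1 := hφ S
    rw [h, hφ S'] at h1
    exact Subtype.ext (Finset.coe_injective (Fin.val_injective.image_injective h1.symm))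
  have hsurj : ∀ f : Fin k ↪o ℕ, (∀ i, f i < b) → ∃ S, φ S = f := by
    intro f hf
    let f' : Fin k ↪o Fin b := OrderEmbedding.ofStrictMono (fun i => ⟨f i, hf i⟩)
      fun i j hij => f.strictMono hij
    have hcard : (Finset.univ.map f'.toEmbedding).card = k := by simp
    refine ⟨⟨Finset.univ.map f'.toEmbedding, Finset.mem_powersetCard.mpr
      ⟨Finset.subset_univ _, hcard⟩⟩, ?_⟩
    have := Finset.orderEmbOfFin_unique' hcard (f := f') fun i =>
      Finset.mem_map.mpr ⟨i, Finset.mem_univ _, rfl⟩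
    ext i
    change ((Finset.orderEmbOfFin _ _ i : Fin b) : ℕ) = f i
    rw [← this]
    rfl
  have hcoeff : ∀ f : Fin k ↪o ℕ, PowerSeries.coeff (∑ i ∈ Finset.range k, lam i)
      (M.submatrix f f).det = if (∀ i, f i < b) ∧ ∀ n < a, ∃ i, f i = n then
        PowerSeries.constantCoeff (M'.submatrix f f).det else 0 := by
    intro f
    rw [det_submatrix_pow_mul hM, PowerSeries.coeff_X_pow_mul']
    split_ifs with h1 h2 h2
    · rw [sum_orderEmb_eq hconst hak hkb h2.1 h2.2, Nat.sub_self,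
        PowerSeries.coeff_zero_eq_constantCoeff]
    · exact absurd (sum_lt_sum_orderEmb hmono hlow hconst hhigh hak hkb h2) (not_lt.mpr h1)
    · exact absurd (sum_orderEmb_eq hconst hak hkb h2.1 h2.2).le h1
    · rfl
  simp_rw [hcoeff]
  rw [finsum_eq_finsetSum_of_support_subset (s := Finset.univ.image φ)]
  · rw [Finset.sum_image hinj.injOn, ← Finset.sum_coe_sort (Finset.univ.powersetCard k)]
    refine Finset.sum_congr rfl fun S _ => ?_
    have hcond : ((∀ i, φ S i < b) ∧ ∀ n < a, ∃ i, φ S i = n) ↔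
        ∀ i : Fin b, (i : ℕ) < a → i ∈ S.1 := by
      constructor
      · rintro ⟨-, h⟩ i hi
        have : (i : ℕ) ∈ Set.range (φ S) := h i hi
        rw [hφ] at this
        obtain ⟨j, hj, hji⟩ := this
        rwa [← Fin.ext hji]
      · intro h
        refine ⟨fun i => (Finset.orderEmbOfFin _ _ i : Fin b).2, fun n hn => ?_⟩
        have hnb : n < b := by omega
        have : n ∈ Set.range (φ S) := by
          rw [hφ]
          exact ⟨⟨n, hnb⟩, h ⟨n, hnb⟩ hn, rfl⟩
        exact this
    have hdet : PowerSeries.constantCoeff (M'.submatrix (φ S) (φ S)).det =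
        ((Matrix.of fun i j : Fin b => PowerSeries.constantCoeff (M' i j)).submatrix
          (Subtype.val : S.1 → Fin b) (Subtype.val : S.1 → Fin b)).det := by
      rw [RingHom.map_det, ← Matrix.det_submatrix_equiv_self
        (S.1.orderIsoOfFin (Finset.mem_powersetCard.mp S.2).2).toEquiv]
      rfl
    simp only [hcond, hdet]
  · intro f hf
    rw [Function.mem_support] at hf
    have h := (ite_ne_right_iff.mp hf).1
    obtain ⟨S, rfl⟩ := hsurj f h.1
    simp

end Newton

/-! ### Lifting the base change to `R` -/

section LiftConjugation

variable {R F : Type*} [Ring R] [Ring F] {J : Ideal R} [J.IsTwoSided] {T : R} {lam : ℕ → ℕ}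
  {a b c : ℕ}

theorem pow_mul_comm_of_central (hTc : ∀ x : R, T * x = x * T) (n : ℕ) (x : R) :
    T ^ n * x = x * T ^ n :=
  (show Commute T x from hTc x).pow_left n

/-- Lift of a base change over the residue ring to one compatible with Hodge bounds. -/
theorem exists_lift_conjugation (hc : IsCompleteAdic J) (hT : T ∈ J)
    (hTc : ∀ x : R, T * x = x * T) {ρ : R →+* F} (hρ : Function.Surjective ρ)
    (hker : ∀ x, ρ x = 0 ↔ x ∈ J) (hlow : ∀ i < a, lam i < c)
    (hconst : ∀ i, a ≤ i → i < b → lam i = c) {g h l : Matrix (Fin b) (Fin b) F}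
    (hgh : g * h = 1) (hhg : h * g = 1)
    (hg : ∀ i j : Fin b, (i : ℕ) < a ∨ (j : ℕ) < a → g i j = (1 : Matrix (Fin b) (Fin b) F) i j)
    (hl : ∀ i j : Fin b, (i : ℕ) < a ∨ a ≤ j → l i j = 0) :
    ∃ C C' D : Matrix (Fin b) (Fin b) R, C * D = 1 ∧ D * C = 1 ∧
      (∀ i j, C i j * T ^ lam j = T ^ lam i * C' i j) ∧ C'.map ρ = (1 + l) * g ∧ D.map ρ = h := by
  choose σ hσ using hρ
  -- Outside the block `[a, b)` the lift is the identity on the nose, not merely modulo `J`. As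
  -- `lam` is constant on `[a, b)`, `G` commutes with `Diag(T ^ lam)`.
  set G : Matrix (Fin b) (Fin b) R := Matrix.of fun i j =>
    if (i : ℕ) < a ∨ (j : ℕ) < a then (1 : Matrix (Fin b) (Fin b) R) i j else σ (g i j) with hG
  set L : Matrix (Fin b) (Fin b) R := Matrix.of fun i j =>
    if (i : ℕ) < a ∨ a ≤ (j : ℕ) then 0 else σ (l i j) with hL
  -- `Λ Δ = Δ L` with `Λ` zero modulo `J`, since `lam j < lam i` wherever `L` is nonzero. Hence `l`
  -- appears in the reduction of `C'` but not in that of `D`.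
  set Λ : Matrix (Fin b) (Fin b) R := Matrix.of fun i j => T ^ (lam i - lam j) * L i j with hΛ
  have hGρ : G.map ρ = g := by
    ext i j
    rw [Matrix.map_apply, hG, Matrix.of_apply]
    split_ifs with hij
    · rw [hg i j hij, Matrix.one_apply, Matrix.one_apply]
      split_ifs <;> simp
    · exact hσ _
  have hLρ : L.map ρ = l := by
    ext i j
    rw [Matrix.map_apply, hL, Matrix.of_apply]
    split_ifs with hij
    · rw [hl i j hij, map_zero]
    · exact hσ _
  have hL0 : ∀ i j : Fin b, (i : ℕ) < a ∨ a ≤ (j : ℕ) → L i j = 0 := fun i j hij => if_pos hij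
  have hlt : ∀ i j : Fin b, ¬((i : ℕ) < a ∨ a ≤ (j : ℕ)) → lam j < lam i := fun i j hij => by
    rw [hconst i (by omega) i.2]
    exact hlow j (by omega)
  have hΛρ : Λ.map ρ = 0 := by
    ext i j
    rw [Matrix.map_apply, hΛ, Matrix.of_apply, Matrix.zero_apply]
    by_cases hij : (i : ℕ) < a ∨ a ≤ (j : ℕ)
    · rw [hL0 i j hij, mul_zero, map_zero]
    · have := hlt i j hij
      rw [map_mul, map_pow, (hker T).mpr hT, zero_pow (by omega), zero_mul]
  have hΛ0 : Λ * Λ = 0 := by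
    ext i j
    rw [Matrix.mul_apply, Matrix.zero_apply]
    refine Finset.sum_eq_zero fun k _ => ?_
    simp only [hΛ, Matrix.of_apply]
    by_cases hk : (k : ℕ) < a
    · rw [hL0 k j (.inl hk), mul_zero, mul_zero]
    · rw [hL0 i k (.inr (not_lt.mp hk)), mul_zero, zero_mul]
  obtain ⟨H, hGH, hHG, hHρ⟩ := exists_inverse_of_map hc (fun x => ⟨σ x, hσ x⟩) hker
    (A := G) (B := h) (by rw [hGρ, hgh]) (by rw [hGρ, hhg])
  set Δ : Matrix (Fin b) (Fin b) R := Matrix.diagonal fun i => T ^ lam i with hΔ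
  have hGΔ : G * Δ = Δ * G := by
    ext i j
    rw [hΔ, Matrix.mul_diagonal, Matrix.diagonal_mul, pow_mul_comm_of_central hTc]
    by_cases hij : (i : ℕ) < a ∨ (j : ℕ) < a
    · simp only [hG, Matrix.of_apply, if_pos hij, Matrix.one_apply]
      split_ifs with h1
      · rw [h1]
      · rw [zero_mul, zero_mul]
    · rw [hconst i (by omega) i.2, hconst j (by omega) j.2]
  have hΛΔ : Λ * Δ = Δ * L := by
    ext i j
    rw [hΔ, Matrix.mul_diagonal, Matrix.diagonal_mul, hΛ, Matrix.of_apply]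
    by_cases hij : (i : ℕ) < a ∨ a ≤ (j : ℕ)
    · rw [hL0 i j hij, mul_zero, mul_zero, zero_mul]
    · rw [mul_assoc, ← pow_mul_comm_of_central hTc, ← mul_assoc, ← pow_add,
        Nat.sub_add_cancel (hlt i j hij).le]
  have h1 : (1 + Λ) * (1 - Λ) = 1 := by
    rw [add_mul, one_mul, mul_sub, mul_one, hΛ0]
    abel
  have h2 : (1 - Λ) * (1 + Λ) = 1 := by
    rw [sub_mul, one_mul, mul_add, mul_one, hΛ0]
    abel
  refine ⟨(1 + Λ) * G, (1 + L) * G, H * (1 - Λ), ?_, ?_, ?_, ?_, ?_⟩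
  · rw [mul_assoc, ← mul_assoc G, hGH, one_mul, h1]
  · rw [mul_assoc, ← mul_assoc (1 - Λ), h2, one_mul, hHG]
  · have : (1 + Λ) * G * Δ = Δ * ((1 + L) * G) := by
      rw [mul_assoc, hGΔ, ← mul_assoc, add_mul, one_mul, hΛΔ, ← mul_assoc, mul_add, mul_one]
    intro i j
    have := congrFun (congrFun this i) j
    rwa [hΔ, Matrix.mul_diagonal, Matrix.diagonal_mul] at this
  · rw [Matrix.map_mul, hGρ, Matrix.map_add _ (map_add ρ), hLρ,
      Matrix.map_one _ (map_zero ρ) (map_one ρ)]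
  · rw [Matrix.map_mul, hHρ, Matrix.map_sub _ (map_sub ρ), hΛρ,
      Matrix.map_one _ (map_zero ρ) (map_one ρ), sub_zero, mul_one]

end LiftConjugation

/-! ### Vertices and collinear points of the Hodge polygon -/

section NewtonVertex

variable {F : Type*} [Field F] {lam : ℕ → ℕ} {a b c s : ℕ}

theorem mk_mem_newtonRegion {M : Matrix ℕ ℕ (PowerSeries F)} {k n : ℕ}
    (h : newtonFunction M k ≤ n) : ((k : ℝ), (n : ℝ)) ∈ newtonRegion M := by
  obtain ⟨m, hm⟩ := ENat.ne_top_iff_exists.mp (ne_top_of_le_ne_top (ENat.natCast_ne_top n) h)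
  refine subset_convexHull ℝ _ ⟨k, m, hm.symm, rfl, ?_⟩
  rw [← hm, Nat.cast_le] at h
  exact Nat.cast_le.mpr h

theorem sum_range_of_const (hconst : ∀ i, a ≤ i → i < b → lam i = c) {k : ℕ} (hak : a ≤ k)
    (hkb : k ≤ b) : ∑ i ∈ Finset.range k, lam i = ∑ i ∈ Finset.range a, lam i + (k - a) * c := by
  rw [← Finset.sum_range_add_sum_Ico _ hak, Finset.sum_congr rfl fun i hi =>
    hconst i (Finset.mem_Ico.mp hi).1 ((Finset.mem_Ico.mp hi).2.trans_le hkb)]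
  simp

/-- At a vertex inside a segment of constant slope of the Hodge polygon, the Newton polygon cannot
meet that segment on both sides. -/
theorem false_of_newtonFunction_le_of_mem_extremePoints
    (hconst : ∀ i, a ≤ i → i < b → lam i = c) {M : Matrix ℕ ℕ (PowerSeries F)}
    (hext : ((s : ℝ), ((∑ i ∈ Finset.range s, lam i : ℕ) : ℝ)) ∈ (newtonRegion M).extremePoints ℝ)
    {k k' : ℕ} (hk' : a ≤ k') (hk's : k' < s) (hsk : s < k) (hkb : k ≤ b)
    (h : newtonFunction M k ≤ (∑ i ∈ Finset.range k, lam i : ℕ))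
    (h' : newtonFunction M k' ≤ (∑ i ∈ Finset.range k', lam i : ℕ)) : False := by
  have hseg : ((s : ℝ), ((∑ i ∈ Finset.range s, lam i : ℕ) : ℝ)) ∈ openSegment ℝ
      ((k' : ℝ), ((∑ i ∈ Finset.range k', lam i : ℕ) : ℝ))
      ((k : ℝ), ((∑ i ∈ Finset.range k, lam i : ℕ) : ℝ)) := by
    have hd : (0 : ℝ) < (k : ℝ) - k' := by
      rw [sub_pos]; exact_mod_cast hk's.trans hsk
    have h1 : (0 : ℝ) < (k : ℝ) - s := by rw [sub_pos]; exact_mod_cast hsk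
    have h2 : (0 : ℝ) < (s : ℝ) - k' := by rw [sub_pos]; exact_mod_cast hk's
    refine ⟨(k - s) / (k - k'), (s - k') / (k - k'), by positivity, by positivity, ?_, ?_⟩
    · field_simp
      ring
    · rw [sum_range_of_const hconst (k := k) (by omega) hkb,
        sum_range_of_const hconst (k := s) (by omega) (by omega),
        sum_range_of_const hconst (k := k') hk' (by omega)]
      ext
      · simp only [Prod.smul_mk, Prod.mk_add_mk, smul_eq_mul]
        field_simp
        ring
      · simp only [Prod.smul_mk, Prod.mk_add_mk, smul_eq_mul]
        push_cast [Nat.cast_sub (show a ≤ k by omega), Nat.cast_sub (show a ≤ s by omega),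
          Nat.cast_sub hk']
        field_simp
        ring
  have := hext.2 (mk_mem_newtonRegion h') (mk_mem_newtonRegion h) hseg
  have := congrArg Prod.fst this
  simp only [Nat.cast_inj] at this
  omega

end NewtonVertex

/-! ### Reduction to the residue field and conclusion -/

section Reduction

variable {R : Type*} [Ring R] {T : R} {J : Ideal R} {lam : ℕ → ℕ}

/-- The ideal `J` is the kernel of reduction to the residue field. -/
theorem constantCoeff_map_eq_zero_iff {F : Type*} [Field F] {π : R →+* PowerSeries F}
    (hπ : Function.Surjective π) (hπT : π T = PowerSeries.X)
    (hJ : J = RingHom.ker π ⊔ Ideal.span {T}) (x : R) :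
    (PowerSeries.constantCoeff.comp π) x = 0 ↔ x ∈ J := by
  rw [hJ]
  constructor
  · intro hx
    obtain ⟨q, hq⟩ : PowerSeries.X ∣ π x := PowerSeries.X_dvd_iff.mpr hx
    obtain ⟨y, rfl⟩ := hπ q
    have h1 : x - y * T ∈ RingHom.ker π := by
      rw [RingHom.mem_ker, map_sub, map_mul, hπT, hq, mul_comm, sub_self]
    have h2 : y * T ∈ Ideal.span {T} :=
      Ideal.mul_mem_left _ _ (Ideal.subset_span rfl)
    rw [← sub_add_cancel x (y * T)]
    exact Ideal.add_mem _ (Ideal.mem_sup_left h1) (Ideal.mem_sup_right h2)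
  · intro hx
    have hle : RingHom.ker π ⊔ Ideal.span {T} ≤
        RingHom.ker (PowerSeries.constantCoeff.comp π) := by
      refine sup_le (fun y hy => ?_) ?_
      · rw [RingHom.mem_ker] at hy ⊢
        rw [RingHom.comp_apply, hy, map_zero]
      · rw [Ideal.span_singleton_le_iff_mem, RingHom.mem_ker, RingHom.comp_apply, hπT,
          PowerSeries.constantCoeff_X]
    exact hle hx

theorem exists_slope_interval (hmono : Monotone lam) (hlam : Tendsto lam atTop atTop) {s : ℕ}
    (hs : 0 < s) : ∃ a b c, a < s ∧ s ≤ b ∧ (∀ i < a, lam i < c) ∧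
      (∀ i, a ≤ i → i < b → lam i = c) ∧ ∀ i, b ≤ i → c < lam i := by
  -- `c` is the slope just before `s`; `a` and `b` are the first indices where `lam` reaches and
  -- exceeds it.
  classical
  have h1 : ∃ n, lam (s - 1) ≤ lam n := ⟨s - 1, le_rfl⟩
  have h2 : ∃ n, lam (s - 1) < lam n := (hlam.eventually (eventually_gt_atTop _)).exists
  refine ⟨Nat.find h1, Nat.find h2, lam (s - 1), ?_, ?_, fun i hi => not_le.mp (Nat.find_min h1 hi),
    fun i hi hi' => le_antisymm (not_lt.mp (Nat.find_min h2 hi'))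
      ((Nat.find_spec h1).trans (hmono hi)), fun i hi => (Nat.find_spec h2).trans_le (hmono hi)⟩
  · have := Nat.find_min' h1 (le_refl (lam (s - 1)))
    omega
  · by_contra hlt
    exact absurd (Nat.find_spec h2) (not_lt.mpr (hmono (by omega)))

/-- The pencil of the reduction at a vertex of the Newton polygon. -/
theorem coeff_det_pencil_of_vertex {F : Type*} [Field F] (hmono : Monotone lam) {a b c s : ℕ}
    (has : a ≤ s) (hsb : s ≤ b) (hlow : ∀ i < a, lam i < c)
    (hconst : ∀ i, a ≤ i → i < b → lam i = c) (hhigh : ∀ i, b ≤ i → c < lam i)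
    {M M' : Matrix ℕ ℕ (PowerSeries F)} (hM : ∀ i j, M i j = PowerSeries.X ^ lam i * M' i j)
    (hext : ((s : ℝ), ((∑ i ∈ Finset.range s, lam i : ℕ) : ℝ)) ∈ (newtonRegion M).extremePoints ℝ)
    (hN : newtonFunction M s = ((∑ i ∈ Finset.range s, lam i : ℕ) : ℕ∞))
    {A : Matrix (Fin b) (Fin b) F}
    (hA : A = Matrix.of fun i j : Fin b => PowerSeries.constantCoeff (M' i j)) :
    (pencil a A).det.coeff (b - s) ≠ 0 ∧ ((∀ j < b - s, (pencil a A).det.coeff j = 0) ∨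
      ∀ j, b - s < j → j ≤ b - a → (pencil a A).det.coeff j = 0) := by
  have hcoeff : ∀ k, a ≤ k → k ≤ b →
      PowerSeries.coeff (∑ i ∈ Finset.range k, lam i) (principalMinorSum M k) =
        (pencil a A).det.coeff (b - k) := fun k hak hkb => by
    rw [coeff_principalMinorSum hmono hlow hconst hhigh hM hak hkb, hA]
  refine ⟨?_, ?_⟩
  · rw [← hcoeff s has hsb]
    exact ((PowerSeries.order_eq_nat).mp hN).1
  -- Nonzero coefficients on both sides of `b - s` would put the Newton polygon on or below the
  -- Hodge segment at some `k' < s` and some `k > s`.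
  · by_contra! hcon
    obtain ⟨⟨j, hj, hj0⟩, j', hj', hj'a, hj'0⟩ := hcon
    have hle : ∀ k, a ≤ k → k ≤ b → (pencil a A).det.coeff (b - k) ≠ 0 →
        newtonFunction M k ≤ (∑ i ∈ Finset.range k, lam i : ℕ) := fun k hak hkb hne =>
      PowerSeries.order_le _ (by rwa [hcoeff k hak hkb])
    refine false_of_newtonFunction_le_of_mem_extremePoints hconst hext (k := b - j) (k' := b - j')
      (by omega) (by omega) (by omega) (by omega) (hle _ (by omega) (by omega) ?_)
      (hle _ (by omega) (by omega) ?_)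
    · rwa [Nat.sub_sub_self (by omega)]
    · rwa [Nat.sub_sub_self (by omega)]

theorem map_pow_eq_zero_iff_mem_entriesIn {n F : Type*} [Fintype n] [DecidableEq n] [Ring F]
    {ρ : R →+* F} (hker : ∀ x, ρ x = 0 ↔ x ∈ J) {A : Matrix n n R} {k : ℕ} :
    A.map ρ ^ k = 0 ↔ A ^ k ∈ entriesIn n n J := by
  rw [← Matrix.map_pow]
  refine ⟨fun h i j => (hker _).mp (congrFun (congrFun h i) j), fun h => ?_⟩
  ext i j
  exact (hker _).mpr (h i j)

theorem exists_blockTriangular_of_vertex {F : Type*} [Field F] {π : R →+* PowerSeries F}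
    (hπ : Function.Surjective π) (hTc : ∀ x : R, T * x = x * T) (hπT : π T = PowerSeries.X)
    (hJ : J = RingHom.ker π ⊔ Ideal.span {T}) (hc : IsCompleteAdic J) (hmono : Monotone lam)
    (hlam : Tendsto lam atTop atTop) {M : Matrix ℕ ℕ R} (hM : IsHodgeBounded T lam M) {s : ℕ}
    (hext : ((s : ℝ), ((∑ i ∈ Finset.range s, lam i : ℕ) : ℝ)) ∈
      (newtonRegion (M.map π)).extremePoints ℝ)
    (hN : newtonFunction (M.map π) s = ((∑ i ∈ Finset.range s, lam i : ℕ) : ℕ∞)) :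
    ∃ Q Q' : Matrix ℕ ℕ R, IsInversePair J Q Q' ∧ IsStable J T lam Q ∧
      ∃ P N : Matrix ℕ ℕ R, IsMatProd J Q M P ∧ IsMatProd J P Q' N ∧
        IsHodgeBounded T lam N ∧ ∀ i j, s ≤ i → j < s → N i j = 0 := by
  obtain ⟨M', hM'⟩ := hM
  set ρ : R →+* F := PowerSeries.constantCoeff.comp π with hρdef
  have hρ : Function.Surjective ρ := PowerSeries.constantCoeff_surj.comp hπ
  have hker : ∀ x, ρ x = 0 ↔ x ∈ J := constantCoeff_map_eq_zero_iff hπ hπT hJ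
  have hJker : J = RingHom.ker ρ := by
    ext x
    rw [RingHom.mem_ker, hker]
  have : J.IsTwoSided := hJker ▸ inferInstance
  have hT : T ∈ J := hJ ▸ Ideal.mem_sup_right (Ideal.subset_span rfl)
  let _ : TopologicalSpace R := (ringSubgroupsBasis_pow J).topology
  have : IsTopologicalRing R := (ringSubgroupsBasis_pow J).toRingFilterBasis.isTopologicalRing
  let _ : UniformSpace R := IsTopologicalAddGroup.rightUniformSpace R
  have : IsUniformAddGroup R := isUniformAddGroup_of_addCommGroup
  have hadic : IsAdicTopology J := by
    have := (ringSubgroupsBasis_pow J).hasBasis_nhds_zero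
    exact this
  have := hadic.nonarchimedeanRing
  have := hadic.t2Space hc
  have := hadic.completeSpace hc
  -- For `s = 0` there is no slope before the vertex, but the block condition is empty and `Q = 1`
  -- works.
  rcases Nat.eq_zero_or_pos s with rfl | hs
  · have h1 : ColNull (1 : Matrix ℕ ℕ R) := ColNull.one
    have hM0 : ColNull M := IsHodgeBounded.colNull hadic hT hlam ⟨M', hM'⟩
    have h1M : ∀ {B : Matrix ℕ ℕ R}, ColNull B → IsMatProd J 1 B B := fun {B} hB => by
      simpa only [one_infMul] using isMatProd_infMul hadic 1 hB
    have hM1 : ∀ B : Matrix ℕ ℕ R, IsMatProd J B 1 B := fun B => by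
      simpa only [infMul_one] using isMatProd_infMul hadic B h1
    have hnull : IsColumnNull J (1 : Matrix ℕ ℕ R) := fun j => hadic.adicTendsto_iff.mpr (h1 j)
    exact ⟨1, 1, ⟨hnull, hnull, hM1 1, hM1 1⟩,
      fun B hB => ⟨B, h1M (IsHodgeBounded.colNull hadic hT hlam hB), hB⟩,
      M, M, h1M hM0, hM1 M, ⟨M', hM'⟩, fun i j _ hj => absurd hj (Nat.not_lt_zero j)⟩
  · obtain ⟨a, b, c, has, hsb, hlow, hconst, hhigh⟩ := exists_slope_interval hmono hlam hs
    set A : Matrix (Fin b) (Fin b) R :=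
      M'.submatrix (Fin.val : Fin b → ℕ) (Fin.val : Fin b → ℕ) with hA
    obtain ⟨hs0, hv⟩ := coeff_det_pencil_of_vertex hmono has.le hsb hlow hconst hhigh
      (M := M.map π) (M' := M'.map π) (by simp [hM', hπT]) hext hN (A := A.map ρ) rfl
    obtain ⟨g, h, l, hgh, hhg, hg, hl, hzero, K₀, hK₀, hK₀', k, hk⟩ :=
      exists_goodForm has.le hsb hs0 hv
    obtain ⟨C, C', D, hCD, hDC, hCC', hC'ρ, hDρ⟩ :=
      exists_lift_conjugation hc hT hTc hρ hker hlow hconst hgh hhg hg hl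
    have hNρ : (C' * A * D).map ρ = (1 + l) * (g * A.map ρ * h) := by
      rw [Matrix.map_mul, Matrix.map_mul, hC'ρ, hDρ]
      simp only [mul_assoc]
    have hhead : ((C' * A * D).submatrix (Fin.castLE hsb) (Fin.castLE hsb)).map ρ =
        headBlock hsb ((1 + l) * (g * A.map ρ * h)) := by
      rw [← hNρ]
      rfl
    rw [← hhead] at hK₀ hK₀'
    -- The inverse of the head block lifts from the residue field to `R`, so nilpotency of the
    -- reduced `tailProj * K₀` becomes nilpotency modulo `J` of `tailProj * K`.
    obtain ⟨K, -, hK, rfl⟩ := exists_inverse_of_map hc hρ hker hK₀ hK₀'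
    refine exists_blockTriangular hadic hc hT hTc hmono hlam hsb (a := a) ?_ ?_ hM' hCD hDC hCC'
      rfl ?_ hK (k := k) (hk.imp ?_ ?_)
    · rintro i j hi (hib | hja)
      · refine (hmono (show (j : ℕ) ≤ s - 1 by omega)).trans_lt ?_
        rw [hconst (s - 1) (by omega) (by omega)]
        exact hhigh i hib
      · refine (hlow j hja).trans_le ?_
        rw [← hconst (s - 1) (by omega) (by omega)]
        exact hmono (by omega)
    · intro i j hi hib haj
      rw [hconst i (by omega) hib, hconst j haj (by omega)]
    · intro i j hi hj
      rw [← hker, ← Matrix.map_apply (f := ρ), hNρ]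
      exact hzero i j hi hj
    · intro hk
      rw [← map_pow_eq_zero_iff_mem_entriesIn hker, ← hk, ← hNρ]
      congr 1
      ext i j
      rw [Matrix.map_apply, Matrix.of_apply, apply_ite ρ, map_zero]
      rfl
    · intro hk
      rw [← map_pow_eq_zero_iff_mem_entriesIn hker, ← hk, Matrix.map_mul]
      congr 2
      ext i j
      simp only [tailProj, Matrix.map_apply, Matrix.diagonal_apply]
      split_ifs <;> simp

end Reduction

end NewtonHodge

theorem theorem2p23 {p : ℕ} [Fact p.Prime] {R : Type*} [Ring R]
    (π : R →+* PowerSeries (ZMod p)) (hπ : Function.Surjective π)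
    (T : R) (hTcenter : ∀ x : R, T * x = x * T) (hTreg : T ∈ nonZeroDivisors R)
    (hπT : π T = PowerSeries.X)
    (J : Ideal R) (hJ : J = RingHom.ker π ⊔ Ideal.span {T})
    (hcomplete : IsCompleteAdic J)
    (hlift : ∀ a : PowerSeries (ZMod p), ∃ x : R, π x = a ∧ emultiplicity T x = a.order)
    (lam : ℕ → ℕ) (hmono : Monotone lam) (hlam : Tendsto lam atTop atTop)
    (M : Matrix ℕ ℕ R) (hM : IsHodgeBounded T lam M)
    (s : ℕ → ℕ) (hs : StrictMono s)
    (htouch : ∀ k, IsTouchingVertex (M.map π) (s k))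
    (hNewton : ∀ k, newtonFunction (M.map π) (s k) =
      ((∑ i ∈ Finset.range (s k), lam i : ℕ) : ℕ∞)) :
    ∃ Q Q' : Matrix ℕ ℕ R, IsInversePair J Q Q' ∧ IsStable J T lam Q ∧
      ∃ P N : Matrix ℕ ℕ R, IsMatProd J Q M P ∧ IsMatProd J P Q' N ∧
        IsHodgeBounded T lam N ∧ ∀ i j, s 0 ≤ i → j < s 0 → N i j = 0 := by
  obtain ⟨⟨n, hn, hext⟩, -⟩ := htouch 0
  rw [hNewton 0, Nat.cast_inj] at hn
  rw [← hn] at hext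
  exact exists_blockTriangular_of_vertex hπ hTcenter hπT hJ hcomplete hmono hlam hM hext (hNewton 0)
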